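/- **Setting.** Let $k$ be a field of characteristic $p>0$ and let $G$ be a topological group with an open subgroup $I$ which is pro-$p$. Let $\operatorname{Rep}_k^\infty(G)$ be the category of smooth $k$-linear representations of $G$ (the stabilizer of every vector is open). Let $\mathbb X=\operatorname{ind}_I^G(k)$ be the space of compactly supported functions $f:G\to k$ with $f(gi)=f(g)$ for all $g\in G$, $i\in I$, on which $G$ acts by $(gf)(g')=f(g^{-1}g')$, and let $1_{gI}\in\mathbb X$ denote the characteristic function of $gI$. Put $H=\operatorname{End}_G(\mathbb X)^{\mathrm{op}}$ and let $\operatorname{Mod}(H)$ be the category of left $H$-modules. The functors $F:\operatorname{Mod}(H)\rightleftarrows\operatorname{Rep}_k^\infty(G):U$ given by $FM=\mathbb X\otimes_H M$ and $UV=V^I\cong\operatorname{Hom}_G(\mathbb X,V)$ are adjoint, with unit $m\mapsto 1_I\otimes m$ and counit $1_{gI}\otimes v\mapsto gv$. Let $\operatorname{Ch}(H)$ and $\operatorname{Ch}(G)$ be the categories of unbounded chain complexes over $\operatorname{Mod}(H)$ and $\operatorname{Rep}_k^\infty(G)$; applied termwise, $F$ and $U$ give an adjunction $F:\operatorname{Ch}(H)\rightleftarrows\operatorname{Ch}(G):U$.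 Model categories are understood in the sense of Hovey's book (bicomplete, with functorial factorizations). The projective model structure on $\operatorname{Ch}(H)$ is the one whose fibrations are the termwise surjective chain maps and whose weak equivalences are the quasi-isomorphisms; $D(H)$ is the localization of $\operatorname{Ch}(H)$ at the quasi-isomorphisms. **Proposition.** 1. There is a cofibrantly generated model structure on $\operatorname{Ch}(G)$, called the *$I$-projective model structure*, in which a chain map $f:V_\bullet\to W_\bullet$ is a fibration if and only if $Uf:V_\bullet^I\to W_\bullet^I$ is termwise surjective, and a weak equivalence if and only if $Uf$ is a quasi-isomorphism. 2. With respect to the projective model structure on $\operatorname{Ch}(H)$ (which exists) and the $I$-projective model structure on $\operatorname{Ch}(G)$, the adjunction $F:\operatorname{Ch}(H)\rightleftarrows\operatorname{Ch}(G):U$ is a Quillen equivalence: $F$ preserves cofibrations and trivial cofibrations, and for $X$ cofibrant in $\operatorname{Ch}(H)$ and $Y$ fibrant in $\operatorname{Ch}(G)$ a morphism $FX\to Y$ is a weak equivalence if and only if its adjoint $X\to UY$ is. 3. In particular, let $\operatorname{Ho}(\operatorname{Ch}(G))$ be the localization of $\operatorname{Ch}(G)$ at the weak equivalences of the $I$-projective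 model structure. The total left derived functor $LF$ of $F$ and the total right derived functor $RU$ of $U$ exist and are computed on cofibrant and on fibrant objects, respectively, and the derived adjunction $LF:D(H)\rightleftarrows\operatorname{Ho}(\operatorname{Ch}(G)):RU$ induced by $F\dashv U$ is an equivalence of categories, i.e. its unit and counit are isomorphisms. -/

import Mathlib

open CategoryTheory Limits HomotopicalAlgebra
open scoped TensorProduct

universe w v u

/-! ### Pro-`p` groups -/

/-- A profinite group `P` is pro-`p` if every open normal subgroup has `p`-power index. -/
def IsProP (p : ℕ) (P : Type*) [Group P] [TopologicalSpace P] [CompactSpace P] [T2Space P]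
    [TotallyDisconnectedSpace P] : Prop :=
  ∀ N : Subgroup P, N.Normal → IsOpen (N : Set P) → ∃ n : ℕ, N.index = p ^ n

/-! ### Smooth representations -/

section SmoothVectors

variable {k G V : Type*} [Field k] [Group G] [TopologicalSpace G] [IsTopologicalGroup G]
  [AddCommGroup V] [Module k V]

/-- A representation is smooth if the stabilizer of every vector is open. -/
def Representation.IsSmooth (ρ : Representation k G V) : Prop :=
  ∀ v : V, IsOpen {g : G | ρ g v = v}

/-- A vector whose stabilizer contains an open subgroup has an open stabilizer. -/
theorem Representation.isOpen_stab_of_le (ρ : Representation k G V) (v : V) (U : Set G)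
    (hU : IsOpen U) (h1 : (1 : G) ∈ U) (h : ∀ g ∈ U, ρ g v = v) :
    IsOpen {g : G | ρ g v = v} := by
  let S : Subgroup G :=
    { carrier := {g : G | ρ g v = v}
      mul_mem' := fun {a b} ha hb => by
        simp only [Set.mem_ofPred_eq] at *
        rw [map_mul, Module.End.mul_apply, hb, ha]
      one_mem' := by simp
      inv_mem' := fun {a} ha => by
        simp only [Set.mem_ofPred_eq] at *
        conv_lhs => rw [← ha]
        simp }
  exact S.isOpen_of_mem_nhds (g := 1) (Filter.mem_of_superset (hU.mem_nhds h1) h)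

/-- The vectors with open stabilizer form a `k`-subspace. -/
def Representation.smoothVectors (ρ : Representation k G V) : Submodule k V where
  carrier := {v | IsOpen {g : G | ρ g v = v}}
  zero_mem' := by simp
  add_mem' {v v'} hv hv' := by
    refine ρ.isOpen_stab_of_le _ _ (hv.inter hv') ⟨by simp, by simp⟩ ?_
    rintro g ⟨h, h'⟩
    simp only [Set.mem_ofPred_eq] at h h'
    rw [map_add, h, h']
  smul_mem' c v hv := by
    refine ρ.isOpen_stab_of_le _ _ hv (by simp) ?_
    intro g h
    simp only [Set.mem_ofPred_eq] at h
    rw [map_smul, h]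

end SmoothVectors

section Setup

variable (k G : Type u) [Field k] [Group G] [TopologicalSpace G] [IsTopologicalGroup G]

/-- The category of smooth `k`-linear representations of `G`, as a full subcategory of the
category of all `k`-linear representations of `G`. -/
abbrev SmoothRep : Type (u + 1) :=
  ObjectProperty.FullSubcategory (fun V : Rep.{u} k G => V.ρ.IsSmooth)

namespace SmoothRep

variable {k G}

/-- The smooth representation given by a smooth homomorphism `ρ : G → GL(V)`. -/
abbrev of {V : Type u} [AddCommGroup V] [Module k V] (ρ : Representation k G V)
    (h : ρ.IsSmooth) : SmoothRep k G := ⟨Rep.of ρ, h⟩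

/-- The `G`-equivariant `k`-linear map underlying a morphism. -/
abbrev toLin {V W : SmoothRep k G} (f : V ⟶ W) : V.obj.V →ₗ[k] W.obj.V := f.hom.hom.toLinearMap

/-- A morphism of smooth representations from a `G`-equivariant `k`-linear map. -/
abbrev mkHom {V W : SmoothRep k G} (f : V.obj.V →ₗ[k] W.obj.V)
    (h : ∀ g x, f (V.obj.ρ g x) = W.obj.ρ g (f x)) : V ⟶ W :=
  ObjectProperty.homMk (Rep.ofHom ⟨f, fun g => by ext x; exact h g x⟩)

theorem toLin_comm {V W : SmoothRep k G} (f : V ⟶ W) (g : G) (x : V.obj.V) :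
    toLin f (V.obj.ρ g x) = W.obj.ρ g (toLin f x) := LinearMap.congr_fun (f.hom.hom.isIntertwining' g) x

theorem hom_ext' {V W : SmoothRep k G} {f g : V ⟶ W} (h : ∀ x, toLin f x = toLin g x) :
    f = g := by
  apply ObjectProperty.hom_ext
  apply Rep.hom_ext
  ext x
  exact h x

end SmoothRep

/-! ### The compactly induced representation `𝕏` and the Hecke algebra `H` -/

section CompactInduction

variable {G} (I : OpenSubgroup G)

/-- The space of compactly supported functions `f : G → k` with `f (g i) = f g` for `i ∈ I`. -/
def cIndSpace : Submodule k (G → k) where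
  carrier := {f | (∀ g : G, ∀ i ∈ I, f (g * i) = f g) ∧ HasCompactSupport f}
  zero_mem' := ⟨fun _ _ _ => rfl, HasCompactSupport.zero⟩
  add_mem' {f f'} hf hf' :=
    ⟨fun g i hi => by simp [hf.1 g i hi, hf'.1 g i hi], hf.2.add hf'.2⟩
  smul_mem' c f hf :=
    ⟨fun g i hi => by simp [hf.1 g i hi],
      hf.2.comp_left (g := fun x => c • x) (smul_zero c)⟩

/-- The left translation action `(g f) g' = f (g⁻¹ g')` on `cIndSpace k I`. -/
def cIndRep : Representation k G (cIndSpace k I) where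
  toFun g :=
    { toFun := fun f => ⟨fun g' => f.1 (g⁻¹ * g'),
        ⟨fun g' i hi => by
            change f.1 (g⁻¹ * (g' * i)) = f.1 (g⁻¹ * g')
            rw [← mul_assoc, f.2.1 _ i hi],
          f.2.2.comp_homeomorph (Homeomorph.mulLeft g⁻¹)⟩⟩
      map_add' := fun _ _ => rfl
      map_smul' := fun _ _ => rfl }
  map_one' := by ext f g'; simp
  map_mul' a b := by ext f g'; simp [mul_assoc]

theorem cIndRep_apply (g : G) (f : cIndSpace k I) (g' : G) :
    (cIndRep k I g f).1 g' = f.1 (g⁻¹ * g') := rfl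

open scoped Classical in
/-- The characteristic function `1_I` of `I`. -/
noncomputable def charI [CompactSpace I] : cIndSpace k I :=
  ⟨fun g => if g ∈ I then 1 else 0,
    ⟨fun g i hi => by
        have h : g * i ∈ I ↔ g ∈ I := I.toSubgroup.mul_mem_cancel_right hi
        simp only [h],
      HasCompactSupport.intro' (K := (I : Set G)) (isCompact_iff_compactSpace.2 inferInstance)
        I.isClosed (fun g hg => if_neg hg)⟩⟩

open scoped Classical in
theorem charI_apply [CompactSpace I] (g : G) :
    (charI k I).1 g = if g ∈ I then 1 else 0 := rfl

variable {k I}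

/-- The function on `G ⧸ I` induced by a function in `cIndSpace k I`. -/
def cIndQuot (f : cIndSpace k I) : G ⧸ I.toSubgroup → k :=
  Quotient.lift f.1 (fun a b hab => by
    have h : a⁻¹ * b ∈ I := QuotientGroup.leftRel_apply.1 hab
    have := f.2.1 a _ h
    rw [mul_inv_cancel_left] at this
    exact this.symm)

theorem cIndQuot_mk (f : cIndSpace k I) (g : G) :
    cIndQuot f (QuotientGroup.mk g) = f.1 g := rfl

theorem cIndQuot_finite (f : cIndSpace k I) : (Function.support (cIndQuot f)).Finite := by
  have : DiscreteTopology (G ⧸ I.toSubgroup) := QuotientGroup.discreteTopology I.isOpen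
  have h := (f.2.2.isCompact.image
    (QuotientGroup.continuous_mk (N := I.toSubgroup))).finite_of_discrete
  refine h.subset ?_
  intro q
  induction q using QuotientGroup.induction_on with
  | H g => exact fun hq => ⟨g, subset_tsupport _ hq, rfl⟩

variable (k I) in
/-- The linear map sending `f` to the finitely supported function it induces on `G ⧸ I`. -/
noncomputable def cIndToFinsupp : cIndSpace k I →ₗ[k] (G ⧸ I.toSubgroup →₀ k) where
  toFun f := Finsupp.ofSupportFinite (cIndQuot f) (cIndQuot_finite f)
  map_add' f f' := by
    ext q
    induction q using QuotientGroup.induction_on with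
    | H g => rfl
  map_smul' c f := by
    ext q
    induction q using QuotientGroup.induction_on with
    | H g => rfl

theorem cIndToFinsupp_mk (f : cIndSpace k I) (g : G) :
    cIndToFinsupp k I f (QuotientGroup.mk g) = f.1 g := rfl

theorem cIndToFinsupp_injective : Function.Injective (cIndToFinsupp k I) := by
  intro f f' h
  ext g
  exact DFunLike.congr_fun h (QuotientGroup.mk g)

open scoped Classical in
theorem cIndToFinsupp_translate [CompactSpace I] (g : G) :
    cIndToFinsupp k I (cIndRep k I g (charI k I)) =
      Finsupp.single (QuotientGroup.mk g) 1 := by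
  ext q
  induction q using QuotientGroup.induction_on with
  | H g' =>
    rw [cIndToFinsupp_mk, cIndRep_apply, charI_apply, Finsupp.single_apply]
    congr 1
    exact propext QuotientGroup.eq.symm

/-- `cIndSpace k I` is spanned by the translates of `1_I`. -/
theorem cInd_span [CompactSpace I] :
    Submodule.span k (Set.range fun g : G => cIndRep k I g (charI k I)) = ⊤ := by
  rw [eq_top_iff]
  rintro f -
  have h : f = (cIndToFinsupp k I f).sum
      (fun q a => a • cIndRep k I q.out (charI k I)) := by
    apply cIndToFinsupp_injective
    rw [map_finsuppSum]
    simp only [map_smul, cIndToFinsupp_translate, QuotientGroup.out_eq', Finsupp.smul_single,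
      smul_eq_mul, mul_one, Finsupp.sum_single]
  rw [h]
  exact Submodule.sum_mem _ fun q _ =>
    Submodule.smul_mem _ _ (Submodule.subset_span ⟨q.out, rfl⟩)

theorem cIndRep_charI [CompactSpace I] (i : G) (hi : i ∈ I) :
    cIndRep k I i (charI k I) = charI k I := by
  ext g
  rw [cIndRep_apply, charI_apply, charI_apply]
  congr 1
  exact propext (I.toSubgroup.mul_mem_cancel_left (I.toSubgroup.inv_mem hi))

variable (k I) in
theorem cIndRep_isSmooth [CompactSpace I] : (cIndRep k I).IsSmooth := by
  suffices h : (cIndRep k I).smoothVectors = ⊤ by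
    intro f
    have : f ∈ (cIndRep k I).smoothVectors := h ▸ Submodule.mem_top
    exact this
  rw [eq_top_iff, ← cInd_span, Submodule.span_le]
  rintro _ ⟨g, rfl⟩
  refine (cIndRep k I).isOpen_stab_of_le _ ((fun x => g⁻¹ * x * g) ⁻¹' (I : Set G))
    (I.isOpen.preimage (by fun_prop)) (by simp [one_mem]) ?_
  intro x hx
  have h := cIndRep_charI (k := k) _ hx
  calc cIndRep k I x (cIndRep k I g (charI k I))
      = cIndRep k I g (cIndRep k I (g⁻¹ * x * g) (charI k I)) := by
        rw [← Module.End.mul_apply, ← map_mul, ← Module.End.mul_apply, ← map_mul]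
        congr 2; group
    _ = _ := by rw [h]

variable (k I) in
/-- The smooth representation `𝕏 = ind_I^G(k)`. -/
noncomputable def cInd [CompactSpace I] : SmoothRep k G :=
  SmoothRep.of (cIndRep k I) (cIndRep_isSmooth k I)

variable (k I) in
/-- The characteristic function `1_I` as an element of `𝕏`. -/
noncomputable def oneI [CompactSpace I] : (cInd k I).obj.V := charI k I

variable (k I) in
/-- The Hecke algebra `H = End_G(𝕏)ᵒᵖ`. -/
abbrev Hecke [CompactSpace I] : Type u := (End (cInd k I))ᵐᵒᵖ

variable [CompactSpace I]

/-! ### The functor `U` of `I`-invariants -/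

variable (I) in
/-- The space `V^I` of `I`-invariants. -/
def invSpace (V : SmoothRep k G) : Submodule k V.obj.V where
  carrier := {v | ∀ i ∈ I, V.obj.ρ i v = v}
  zero_mem' _ _ := map_zero _
  add_mem' hv hv' i hi := by rw [map_add, hv i hi, hv' i hi]
  smul_mem' c v hv i hi := by rw [map_smul, hv i hi]

theorem oneI_mem : oneI k I ∈ invSpace I (cInd k I) := fun i hi => cIndRep_charI i hi

theorem map_mem_invSpace {V W : SmoothRep k G} (f : V ⟶ W) {v : V.obj.V}
    (hv : v ∈ invSpace I V) : SmoothRep.toLin f v ∈ invSpace I W := fun i hi => by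
  rw [← SmoothRep.toLin_comm, hv i hi]

/-- For `v ∈ V^I`, the map `G ⧸ I → V`, `g I ↦ g v`. -/
def orbitMap {V : SmoothRep k G} (v : invSpace I V) : G ⧸ I.toSubgroup → V.obj.V :=
  Quotient.lift (fun g => V.obj.ρ g v.1) (fun a b hab => by
    have h : a⁻¹ * b ∈ I := QuotientGroup.leftRel_apply.1 hab
    have h2 := v.2 _ h
    calc V.obj.ρ a v.1 = V.obj.ρ a (V.obj.ρ (a⁻¹ * b) v.1) := by rw [h2]
      _ = V.obj.ρ b v.1 := by
        rw [← Module.End.mul_apply, ← map_mul, mul_inv_cancel_left])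

/-- For `v ∈ V^I`, the `k`-linear map `𝕏 → V` with `1_{gI} ↦ g v`. -/
noncomputable def frobLin {V : SmoothRep k G} (v : invSpace I V) :
    (cInd k I).obj.V →ₗ[k] V.obj.V :=
  (Finsupp.linearCombination k (orbitMap v)).comp (cIndToFinsupp k I)

theorem frobLin_translate {V : SmoothRep k G} (v : invSpace I V) (g : G) :
    frobLin v ((cInd k I).obj.ρ g (oneI k I)) = V.obj.ρ g v.1 := by
  change Finsupp.linearCombination k (orbitMap v)
    (cIndToFinsupp k I (cIndRep k I g (charI k I))) = _
  rw [cIndToFinsupp_translate, Finsupp.linearCombination_single, one_smul]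
  rfl

theorem frobLin_oneI {V : SmoothRep k G} (v : invSpace I V) :
    frobLin v (oneI k I) = v.1 := by
  have := frobLin_translate v 1
  simpa using this

/-- Linear maps out of `𝕏` agreeing on all translates of `1_I` are equal. -/
theorem cInd_lin_ext {W : Type*} [AddCommGroup W] [Module k W]
    {f f' : (cInd k I).obj.V →ₗ[k] W}
    (h : ∀ g, f ((cInd k I).obj.ρ g (oneI k I)) = f' ((cInd k I).obj.ρ g (oneI k I))) :
    f = f' := by
  apply LinearMap.ext_on_range (v := fun g : G => cIndRep k I g (charI k I)) cInd_span
  exact h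

/-- For `v ∈ V^I`, the `G`-equivariant map `𝕏 → V` with `1_{gI} ↦ g v`. -/
noncomputable def frobHom {V : SmoothRep k G} (v : invSpace I V) : cInd k I ⟶ V :=
  SmoothRep.mkHom (frobLin v) (fun g x => by
    have : (frobLin v).comp ((cInd k I).obj.ρ g) = (V.obj.ρ g).comp (frobLin v) := by
      apply cInd_lin_ext
      intro g'
      rw [LinearMap.comp_apply, LinearMap.comp_apply, frobLin_translate,
        ← Module.End.mul_apply, ← map_mul, frobLin_translate, map_mul, Module.End.mul_apply]
    exact LinearMap.congr_fun this x)

theorem frobHom_oneI {V : SmoothRep k G} (v : invSpace I V) :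
    SmoothRep.toLin (frobHom v) (oneI k I) = v.1 := frobLin_oneI v

/-- Morphisms out of `𝕏` agreeing on `1_I` are equal. -/
theorem cInd_hom_ext {V : SmoothRep k G} {f f' : cInd k I ⟶ V}
    (h : SmoothRep.toLin f (oneI k I) = SmoothRep.toLin f' (oneI k I)) : f = f' := by
  apply SmoothRep.hom_ext'
  have : SmoothRep.toLin f = SmoothRep.toLin f' := cInd_lin_ext fun g => by
    rw [SmoothRep.toLin_comm, SmoothRep.toLin_comm, h]
  exact LinearMap.congr_fun this

variable (I) in
/-- Frobenius reciprocity `Hom_G(𝕏, V) ≃ V^I`, `φ ↦ φ(1_I)`. -/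
noncomputable def frobEquiv (V : SmoothRep k G) : (cInd k I ⟶ V) ≃+ invSpace I V where
  toFun f := ⟨SmoothRep.toLin f (oneI k I), map_mem_invSpace f oneI_mem⟩
  invFun v := frobHom v
  left_inv _ := cInd_hom_ext (frobHom_oneI _)
  right_inv v := Subtype.ext (frobHom_oneI v)
  map_add' _ _ := rfl

theorem frobHom_comp {V W : SmoothRep k G} (v : invSpace I V) (f : V ⟶ W) :
    frobHom v ≫ f = frobHom ⟨SmoothRep.toLin f v.1, map_mem_invSpace f v.2⟩ := by
  apply cInd_hom_ext
  rw [frobHom_oneI]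
  exact congrArg (SmoothRep.toLin f) (frobHom_oneI v)

/-- The left `H`-module structure on `V^I`: it corresponds under `Hom_G(𝕏, V) ≃ V^I` to
precomposition with endomorphisms of `𝕏`. -/
noncomputable instance invSpaceModule (V : SmoothRep k G) :
    Module (Hecke k I) (invSpace I V) where
  smul h v := frobEquiv I V (h • (frobEquiv I V).symm v)
  one_smul v := by
    change frobEquiv I V ((1 : Hecke k I) • (frobEquiv I V).symm v) = v
    simp
  mul_smul h h' v := by
    change frobEquiv I V ((h * h') • (frobEquiv I V).symm v) =
      frobEquiv I V (h • (frobEquiv I V).symm (frobEquiv I V (h' • (frobEquiv I V).symm v)))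
    rw [AddEquiv.symm_apply_apply, mul_smul]
  smul_zero h := by
    change frobEquiv I V (h • (frobEquiv I V).symm 0) = 0
    simp
  smul_add h v v' := by
    change frobEquiv I V (h • (frobEquiv I V).symm (v + v')) =
      frobEquiv I V (h • (frobEquiv I V).symm v) + frobEquiv I V (h • (frobEquiv I V).symm v')
    simp
  add_smul h h' v := by
    change frobEquiv I V ((h + h') • (frobEquiv I V).symm v) =
      frobEquiv I V (h • (frobEquiv I V).symm v) + frobEquiv I V (h' • (frobEquiv I V).symm v)
    rw [add_smul, map_add]
  zero_smul v := by
    change frobEquiv I V ((0 : Hecke k I) • (frobEquiv I V).symm v) = 0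
    rw [zero_smul, map_zero]

/-- Explicitly, `h v = φ(h(1_I))` where `φ : 𝕏 → V` is the map with `φ(1_{gI}) = g v`. -/
theorem invSpace_smul_coe {V : SmoothRep k G} (h : Hecke k I) (v : invSpace I V) :
    (h • v).1 = SmoothRep.toLin (frobHom v) (SmoothRep.toLin h.unop (oneI k I)) := rfl

/-- The `H`-linear map `V^I → W^I` induced by a morphism `V → W`. -/
noncomputable def invMap {V W : SmoothRep k G} (f : V ⟶ W) :
    invSpace I V →ₗ[Hecke k I] invSpace I W where
  toFun v := ⟨SmoothRep.toLin f v.1, map_mem_invSpace f v.2⟩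
  map_add' v v' := Subtype.ext (map_add _ _ _)
  map_smul' h v := by
    apply Subtype.ext
    change SmoothRep.toLin f (SmoothRep.toLin (frobHom v) (SmoothRep.toLin h.unop (oneI k I))) =
      SmoothRep.toLin (frobHom ⟨SmoothRep.toLin f v.1, map_mem_invSpace f v.2⟩)
        (SmoothRep.toLin h.unop (oneI k I))
    rw [← frobHom_comp]
    rfl

variable (k I) in
/-- The functor `U : Rep^∞_k(G) → Mod(H)`, `U V = V^I`. -/
noncomputable def functorU : SmoothRep k G ⥤ ModuleCat.{u} (Hecke k I) where
  obj V := ModuleCat.of (Hecke k I) (invSpace I V)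
  map f := ModuleCat.ofHom (invMap f)
  map_id _ := rfl
  map_comp _ _ := rfl

instance functorU_additive : (functorU k I).Additive where
  map_add := rfl

/-! ### The functor `F = 𝕏 ⊗_H (-)` -/

/-- The relations `x h ⊗ m = x ⊗ h m` defining `𝕏 ⊗_H M` as a quotient of `𝕏 ⊗_ℤ M`. Here
`x h = e(x)` if `h ∈ H = End_G(𝕏)ᵒᵖ` is given by the endomorphism `e`. -/
noncomputable def tensorRel (M : ModuleCat.{u} (Hecke k I)) :
    Submodule k ((cInd k I).obj.V ⊗[ℤ] M) :=
  Submodule.span k {z | ∃ (x : (cInd k I).obj.V) (h : Hecke k I) (m : M),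
    z = SmoothRep.toLin h.unop x ⊗ₜ[ℤ] m - x ⊗ₜ[ℤ] (h • m)}

/-- The action of `G` on `𝕏 ⊗_ℤ M` through the left factor. -/
noncomputable def tensorRepZ (M : ModuleCat.{u} (Hecke k I)) :
    Representation k G ((cInd k I).obj.V ⊗[ℤ] M) where
  toFun g := TensorProduct.AlgebraTensorModule.map ((cInd k I).obj.ρ g) LinearMap.id
  map_one' := by
    rw [map_one]
    exact TensorProduct.AlgebraTensorModule.map_id
  map_mul' a b := by
    rw [map_mul]
    exact TensorProduct.AlgebraTensorModule.map_mul _ _ (1 : M →ₗ[ℤ] M) 1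

theorem tensorRepZ_tmul (M : ModuleCat.{u} (Hecke k I)) (g : G) (x : (cInd k I).obj.V) (m : M) :
    tensorRepZ M g (x ⊗ₜ[ℤ] m) = ((cInd k I).obj.ρ g x) ⊗ₜ[ℤ] m := rfl

theorem tensorRel_le_comap (M : ModuleCat.{u} (Hecke k I)) (g : G) :
    tensorRel M ≤ (tensorRel M).comap (tensorRepZ M g) := by
  rw [tensorRel, Submodule.span_le]
  rintro _ ⟨x, h, m, rfl⟩
  refine Submodule.subset_span ⟨(cInd k I).obj.ρ g x, h, m, ?_⟩
  rw [map_sub, tensorRepZ_tmul, tensorRepZ_tmul, SmoothRep.toLin_comm]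

/-- The representation of `G` on `𝕏 ⊗_H M`. -/
noncomputable def tensorRep (M : ModuleCat.{u} (Hecke k I)) :
    Representation k G (((cInd k I).obj.V ⊗[ℤ] M) ⧸ tensorRel M) :=
  (tensorRepZ M).quotient (tensorRel M) (tensorRel_le_comap M)

theorem tensorRep_isSmooth (M : ModuleCat.{u} (Hecke k I)) : (tensorRep M).IsSmooth := by
  intro z
  change z ∈ (tensorRep M).smoothVectors
  obtain ⟨z, rfl⟩ := Submodule.mkQ_surjective _ z
  induction z using TensorProduct.induction_on with
  | zero => rw [map_zero]; exact zero_mem _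
  | add a b ha hb => rw [map_add]; exact add_mem ha hb
  | tmul x m =>
    refine (tensorRep M).isOpen_stab_of_le _ _ ((cInd k I).property x) (by simp) ?_
    intro g hg
    change (tensorRel M).mkQ (((cInd k I).obj.ρ g x) ⊗ₜ[ℤ] m) = _
    rw [hg]

/-- The smooth representation `F M = 𝕏 ⊗_H M`. -/
noncomputable def tensorObj (M : ModuleCat.{u} (Hecke k I)) : SmoothRep k G :=
  SmoothRep.of (tensorRep M) (tensorRep_isSmooth M)

/-- The class of `x ⊗ m` in `𝕏 ⊗_H M`. -/
noncomputable def tensorMk {M : ModuleCat.{u} (Hecke k I)} (x : (cInd k I).obj.V) (m : M) :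
    (tensorObj M).obj.V :=
  (tensorRel M).mkQ (x ⊗ₜ[ℤ] m)

theorem tensorMk_balanced {M : ModuleCat.{u} (Hecke k I)} (h : Hecke k I)
    (x : (cInd k I).obj.V) (m : M) :
    tensorMk (SmoothRep.toLin h.unop x) m = tensorMk x (h • m) :=
  (Submodule.Quotient.eq _).2 (Submodule.subset_span ⟨x, h, m, rfl⟩)

theorem tensorMk_add {M : ModuleCat.{u} (Hecke k I)} (x : (cInd k I).obj.V) (m m' : M) :
    tensorMk x (m + m') = tensorMk x m + tensorMk x m' := by
  rw [tensorMk, TensorProduct.tmul_add, map_add]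
  rfl

theorem tensorObj_ρ {M : ModuleCat.{u} (Hecke k I)} (g : G) (x : (cInd k I).obj.V) (m : M) :
    (tensorObj M).obj.ρ g (tensorMk x m) = tensorMk ((cInd k I).obj.ρ g x) m := rfl

theorem tensorObj_induction {M : ModuleCat.{u} (Hecke k I)} {P : (tensorObj M).obj.V → Prop}
    (h0 : P 0) (h1 : ∀ x m, P (tensorMk x m)) (h2 : ∀ a b, P a → P b → P (a + b)) (z) : P z := by
  obtain ⟨z, rfl⟩ := Submodule.mkQ_surjective _ z
  induction z using TensorProduct.induction_on with
  | zero => rw [map_zero]; exact h0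
  | add a b ha hb => rw [map_add]; exact h2 _ _ ha hb
  | tmul x m => exact h1 x m

/-- The `k`-linear map `𝕏 ⊗_H M → V`, `x ⊗ m ↦ b m x`, induced by a balanced family of
equivariant maps `b m : 𝕏 → V`, additive in `m`. -/
noncomputable def tensorLiftLin {M : ModuleCat.{u} (Hecke k I)} {V : SmoothRep k G}
    (b : M →+ (cInd k I ⟶ V)) (hb : ∀ (h : Hecke k I) (m : M), b (h • m) = h • b m) :
    (tensorObj M).obj.V →ₗ[k] V.obj.V :=
  let c : (cInd k I).obj.V →ₗ[k] M →ₗ[ℤ] V.obj.V :=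
    { toFun := fun x => AddMonoidHom.toIntLinearMap
        { toFun := fun m => SmoothRep.toLin (b m) x
          map_zero' := by rw [map_zero]; rfl
          map_add' := fun m m' => by rw [map_add]; rfl }
      map_add' := fun x y => by ext m; exact map_add (SmoothRep.toLin (b m)) x y
      map_smul' := fun a x => by ext m; exact map_smul (SmoothRep.toLin (b m)) a x }
  (tensorRel M).liftQ (TensorProduct.AlgebraTensorModule.lift c) (by
    rw [tensorRel, Submodule.span_le]
    rintro _ ⟨x, h, m, rfl⟩
    simp only [SetLike.mem_coe, LinearMap.mem_ker, map_sub]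
    rw [sub_eq_zero]
    change SmoothRep.toLin (b m) (SmoothRep.toLin h.unop x) = SmoothRep.toLin (b (h • m)) x
    rw [hb]
    rfl)

/-- The morphism `𝕏 ⊗_H M → V`, `x ⊗ m ↦ b m x`, induced by a balanced family `b`. -/
noncomputable def tensorLift {M : ModuleCat.{u} (Hecke k I)} {V : SmoothRep k G}
    (b : M →+ (cInd k I ⟶ V)) (hb : ∀ (h : Hecke k I) (m : M), b (h • m) = h • b m) :
    tensorObj M ⟶ V :=
  SmoothRep.mkHom (tensorLiftLin b hb)
    (fun g z => by
      induction z using tensorObj_induction with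
      | h0 => simp only [map_zero]
      | h2 a b ha hb => simp only [map_add, ha, hb]
      | h1 x m => exact SmoothRep.toLin_comm (b m) g x)

theorem tensorLift_mk {M : ModuleCat.{u} (Hecke k I)} {V : SmoothRep k G}
    (b : M →+ (cInd k I ⟶ V)) (hb : ∀ (h : Hecke k I) (m : M), b (h • m) = h • b m)
    (x : (cInd k I).obj.V) (m : M) :
    SmoothRep.toLin (tensorLift b hb) (tensorMk x m) = SmoothRep.toLin (b m) x := rfl

theorem tensorHom_ext {M : ModuleCat.{u} (Hecke k I)} {V : SmoothRep k G}
    {f f' : tensorObj M ⟶ V}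
    (h : ∀ x m, SmoothRep.toLin f (tensorMk x m) = SmoothRep.toLin f' (tensorMk x m)) :
    f = f' := by
  apply SmoothRep.hom_ext'
  intro z
  induction z using tensorObj_induction with
  | h0 => simp only [map_zero]
  | h2 a b ha hb => simp only [map_add, ha, hb]
  | h1 x m => exact h x m

/-- The equivariant map `𝕏 → 𝕏 ⊗_H M`, `x ↦ x ⊗ m`. -/
noncomputable def tensorMkHom {M : ModuleCat.{u} (Hecke k I)} (m : M) :
    cInd k I ⟶ tensorObj M :=
  SmoothRep.mkHom
    { toFun := fun x => tensorMk x m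
      map_add' := fun x y => by rw [tensorMk, TensorProduct.add_tmul, map_add]; rfl
      map_smul' := fun a x => by
        rw [tensorMk, ← TensorProduct.smul_tmul', map_smul]; rfl }
    (fun _ _ => rfl)

theorem tensorMkHom_apply {M : ModuleCat.{u} (Hecke k I)} (m : M) (x : (cInd k I).obj.V) :
    SmoothRep.toLin (tensorMkHom m) x = tensorMk x m := rfl

/-- The morphism `id ⊗ f : 𝕏 ⊗_H M → 𝕏 ⊗_H N`. -/
noncomputable def tensorMap {M N : ModuleCat.{u} (Hecke k I)} (f : M ⟶ N) :
    tensorObj M ⟶ tensorObj N :=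
  tensorLift
    { toFun := fun m => tensorMkHom (f.hom m)
      map_zero' := by
        apply SmoothRep.hom_ext'
        intro x
        rw [tensorMkHom_apply, map_zero, tensorMk, TensorProduct.tmul_zero, map_zero]
        rfl
      map_add' := fun m m' => by
        apply SmoothRep.hom_ext'
        intro x
        rw [tensorMkHom_apply, map_add, tensorMk_add]
        rfl }
    (fun h m => by
      apply SmoothRep.hom_ext'
      intro x
      change tensorMk x (f.hom (h • m)) = tensorMk (SmoothRep.toLin h.unop x) (f.hom m)
      rw [map_smul, tensorMk_balanced])

theorem tensorMap_mk {M N : ModuleCat.{u} (Hecke k I)} (f : M ⟶ N) (x : (cInd k I).obj.V)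
    (m : M) : SmoothRep.toLin (tensorMap f) (tensorMk x m) = tensorMk x (f.hom m) := rfl

variable (k I) in
/-- The functor `F : Mod(H) → Rep^∞_k(G)`, `F M = 𝕏 ⊗_H M`. -/
noncomputable def functorF : ModuleCat.{u} (Hecke k I) ⥤ SmoothRep k G where
  obj M := tensorObj M
  map f := tensorMap f
  map_id _ := tensorHom_ext fun _ _ => rfl
  map_comp _ _ := tensorHom_ext fun _ _ => rfl

instance functorF_additive : (functorF k I).Additive where
  map_add := tensorHom_ext fun _ _ => tensorMk_add _ _ _

/-! ### The adjunction `F ⊣ U` -/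

/-- The unit `M → (𝕏 ⊗_H M)^I`, `m ↦ 1_I ⊗ m`. -/
noncomputable def unitFU (M : ModuleCat.{u} (Hecke k I)) :
    M ⟶ (functorU k I).obj ((functorF k I).obj M) :=
  ModuleCat.ofHom
    { toFun := fun m => (frobEquiv I (tensorObj M) (tensorMkHom m) : invSpace I (tensorObj M))
      map_add' := fun m m' => Subtype.ext (tensorMk_add _ _ _)
      map_smul' := fun h m => by
        change frobEquiv I (tensorObj M) (tensorMkHom (h • m)) =
          frobEquiv I (tensorObj M) (h •
            (frobEquiv I (tensorObj M)).symm (frobEquiv I (tensorObj M) (tensorMkHom m)))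
        rw [AddEquiv.symm_apply_apply]
        congr 1
        apply SmoothRep.hom_ext'
        intro x
        exact (tensorMk_balanced h x m).symm }

/-- The counit `𝕏 ⊗_H V^I → V`, `1_{gI} ⊗ v ↦ g v`. -/
noncomputable def counitFU (V : SmoothRep k G) :
    (functorF k I).obj ((functorU k I).obj V) ⟶ V :=
  tensorLift (M := (functorU k I).obj V) (frobEquiv I V).symm.toAddMonoidHom (fun h v => by
    change (frobEquiv I V).symm (frobEquiv I V (h • (frobEquiv I V).symm v)) = _
    rw [AddEquiv.symm_apply_apply]
    rfl)

theorem unitFU_coe (M : ModuleCat.{u} (Hecke k I)) (m : M) :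
    ((unitFU M).hom m : invSpace I (tensorObj M)).1 = tensorMk (oneI k I) m := rfl

theorem counitFU_mk (V : SmoothRep k G) (x : (cInd k I).obj.V) (v : invSpace I V) :
    SmoothRep.toLin (counitFU V) (tensorMk (M := (functorU k I).obj V) x v) =
      SmoothRep.toLin (frobHom v) x := rfl

theorem counitFU_translate (V : SmoothRep k G) (g : G) (v : invSpace I V) :
    SmoothRep.toLin (counitFU V)
      (tensorMk (M := (functorU k I).obj V) ((cInd k I).obj.ρ g (oneI k I)) v) =
        V.obj.ρ g v.1 := by
  rw [counitFU_mk]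
  exact frobLin_translate v g

variable (k I) in
/-- The adjunction `F ⊣ U`. -/
noncomputable def adjFU : functorF k I ⊣ functorU k I where
  unit :=
    { app := unitFU
      naturality := fun _ _ _ => rfl }
  counit :=
    { app := counitFU
      naturality := fun V W f => by
        apply tensorHom_ext (M := (functorU k I).obj V)
        intro x v
        change SmoothRep.toLin (frobHom (invMap f v)) x =
          SmoothRep.toLin f (SmoothRep.toLin (frobHom v) x)
        have := frobHom_comp v f
        change SmoothRep.toLin (frobHom (invMap f v)) x = SmoothRep.toLin (frobHom v ≫ f) x
        rw [this]
        rfl }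
  left_triangle_components M := by
    apply tensorHom_ext
    intro x m
    change SmoothRep.toLin ((frobEquiv I (tensorObj M)).symm
      (frobEquiv I (tensorObj M) (tensorMkHom m))) x = tensorMk x m
    rw [AddEquiv.symm_apply_apply]
    rfl
  right_triangle_components V := by
    apply ModuleCat.hom_ext
    apply LinearMap.ext
    intro v
    exact Subtype.ext (frobHom_oneI (v : invSpace I V))

/-! ### Unbounded chain complexes -/

variable (k I) in
/-- The category `Ch(H)` of unbounded chain complexes of left `H`-modules. -/
abbrev ChH : Type (u + 1) := ChainComplex (ModuleCat.{u} (Hecke k I)) ℤ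

variable (k G) in
/-- The category `Ch(G)` of unbounded chain complexes of smooth representations. -/
abbrev ChG : Type (u + 1) := ChainComplex (SmoothRep k G) ℤ

variable (k I) in
/-- The functor `F : Ch(H) → Ch(G)`, defined termwise. -/
noncomputable abbrev chF : ChH k I ⥤ ChG k G :=
  (functorF k I).mapHomologicalComplex (ComplexShape.down ℤ)

variable (k I) in
/-- The functor `U : Ch(G) → Ch(H)`, defined termwise. -/
noncomputable abbrev chU : ChG k G ⥤ ChH k I :=
  (functorU k I).mapHomologicalComplex (ComplexShape.down ℤ)

variable (k I) in
/-- The adjunction `F ⊣ U` on chain complexes, with unit and counit defined termwise. -/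
noncomputable def chAdj : chF k I ⊣ chU k I where
  unit :=
    { app := fun X => { f := fun n => (adjFU k I).unit.app (X.X n) }
      naturality := fun X Y f => by
        ext n : 1
        exact (adjFU k I).unit.naturality (f.f n) }
  counit :=
    { app := fun X =>
        { f := fun n => (adjFU k I).counit.app (X.X n)
          comm' := fun i j _ => ((adjFU k I).counit.naturality (X.d i j)).symm }
      naturality := fun X Y f => by
        ext n : 1
        exact (adjFU k I).counit.naturality (f.f n) }
  left_triangle_components X := by
    ext n : 1
    exact (adjFU k I).left_triangle_components (X.X n)
  right_triangle_components X := by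
    ext n : 1
    exact (adjFU k I).right_triangle_components (X.X n)

variable (k I) in
/-- The unbounded derived category `D(H)`: the localization of `Ch(H)` at the
quasi-isomorphisms. -/
noncomputable abbrev DerivedH :=
  (HomologicalComplex.quasiIso (ModuleCat.{u} (Hecke k I)) (ComplexShape.down ℤ)).Localization

variable (k I) in
/-- The localization functor `Ch(H) → D(H)`. -/
noncomputable abbrev DerivedH.Q : ChH k I ⥤ DerivedH k I :=
  (HomologicalComplex.quasiIso (ModuleCat.{u} (Hecke k I)) (ComplexShape.down ℤ)).Q

end CompactInduction

end Setup

/-! ### Model categories -/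

section Model

variable (C : Type*) [Category.{v} C]

/-- The requirements on a model category that are not part of `ModelCategory`: all small limits
and colimits exist, and both factorizations can be chosen functorially. -/
structure IsBicompleteFunctorial [ModelCategory C] : Prop where
  hasLimits : HasLimitsOfSize.{w, w} C
  hasColimits : HasColimitsOfSize.{w, w} C
  functorial_cof_trivFib :
    MorphismProperty.HasFunctorialFactorization (cofibrations C) (trivialFibrations C)
  functorial_trivCof_fib :
    MorphismProperty.HasFunctorialFactorization (trivialCofibrations C) (fibrations C)

variable {C}

/-- The object `A` is small relative to the class `D`: there is a cardinal `κ` such that for all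
`κ`-filtered ordinals `J` (limit ordinals in which subsets of cardinality at most `κ` are bounded)
and all `J`-sequences `X` of morphisms in `D`, the functor `Hom(A, -)` preserves the colimit
of `X`. -/
def IsSmallRelative (A : C) (D : MorphismProperty C) : Prop :=
  ∃ κ : Cardinal.{w}, ∀ (J : Type w) [LinearOrder J] [SuccOrder J] [OrderBot J] [WellFoundedLT J]
    [NoMaxOrder J], (∀ S : Set J, Cardinal.mk S ≤ κ → BddAbove S) →
    ∀ {X Y : C} (f : X ⟶ Y) (h : D.TransfiniteCompositionOfShape J f),
      PreservesColimit h.F (coyoneda.obj (Opposite.op A))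

/-- The relative `S`-cell complexes: transfinite compositions of pushouts of elements of `S`. -/
def relativeCells (S : MorphismProperty C) : MorphismProperty C :=
  MorphismProperty.transfiniteCompositions.{w} S.pushouts

variable (C) in
/-- A model category is cofibrantly generated if there are sets `S` and `T` of morphisms whose
domains are small relative to `S`-cell and `T`-cell, respectively, such that the fibrations (resp.
the trivial fibrations) are the morphisms having the right lifting property with respect to `T`
(resp. `S`). -/
def IsCofibrantlyGenerated [ModelCategory C] : Prop :=
  ∃ S T : MorphismProperty C,
    MorphismProperty.IsSmall.{w} S ∧ MorphismProperty.IsSmall.{w} T ∧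
    (∀ ⦃A B : C⦄ (f : A ⟶ B), S f → IsSmallRelative.{w} A (relativeCells.{w} S)) ∧
    (∀ ⦃A B : C⦄ (f : A ⟶ B), T f → IsSmallRelative.{w} A (relativeCells.{w} T)) ∧
    fibrations C = T.rlp ∧ trivialFibrations C = S.rlp

variable {D : Type*} [Category* D] [ModelCategory C] [ModelCategory D] {F : C ⥤ D} {U : D ⥤ C}

/-- An adjunction `F ⊣ U` between model categories is a Quillen adjunction if `F` preserves
cofibrations and trivial cofibrations. -/
structure IsQuillenAdjunction (_adj : F ⊣ U) : Prop where
  cofibration {X Y : C} (f : X ⟶ Y) : cofibrations C f → cofibrations D (F.map f)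
  trivialCofibration {X Y : C} (f : X ⟶ Y) :
    trivialCofibrations C f → trivialCofibrations D (F.map f)

/-- A Quillen adjunction `F ⊣ U` is a Quillen equivalence if, for `X` cofibrant and `Y` fibrant,
a morphism `F X ⟶ Y` is a weak equivalence if and only if its adjoint `X ⟶ U Y` is. -/
structure IsQuillenEquivalence (adj : F ⊣ U) : Prop extends IsQuillenAdjunction adj where
  weakEquivalence_iff (X : C) (Y : D) [IsCofibrant X] [IsFibrant Y] (f : F.obj X ⟶ Y) :
    weakEquivalences D f ↔ weakEquivalences C (adj.homEquiv X Y f)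

end Model

/-- The homotopy category of a model category: its localization at the weak equivalences. -/
abbrev HomotopyCat (C : Type*) [Category* C] [ModelCategory C] :=
  (weakEquivalences C).Localization

/-- The localization functor from a model category to its homotopy category. -/
abbrev HomotopyCat.Q (C : Type*) [Category* C] [ModelCategory C] : C ⥤ HomotopyCat C :=
  (weakEquivalences C).Q

/-! Frobenius reciprocity says that `𝕏` corepresents `U`, just as `H` corepresents the forgetful
functor on `H`-modules. Maps from disks and spheres on such an object `P` are therefore elements and
cycles of `U V`. Right lifting against the maps `0 ⟶ disk` means that `U f` is termwise surjective,
and right lifting against `sphere ⟶ disk` means that `U f` is moreover a quasi-isomorphism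
(`rlp_diskInclusions_iff_surjective`, `rlp_sphereInclusions_eq`). Both model structures then come
from one recognition principle, `modelCategoryOfGenerators`, with `P = H` and `P = 𝕏`.

Two inputs are needed. Smallness: `𝕏` is finitely presentable, because `I` is compact and open and
so `I`-invariants of smooth representations commute with filtered colimits
(`isFinitelyPresentable_cInd`). Acyclicity: a map with left lifting against all fibrations is a
chain homotopy equivalence, since all complexes are fibrant and path objects map to products by
fibrations (`rlp_diskInclusions_llp_le`). Additive functors preserve homotopy equivalences, so
exactness of `U` never enters.

For the Quillen equivalence, the unit `M ⟶ U F M` is an isomorphism for `M = H`, hence for free and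
then for projective `M` (`isIso_unitFU`). Cofibrant complexes have projective terms
(`projective_X_of_llp`), so the unit is an isomorphism on them. As weak equivalences in `Ch(G)` are
created by `U`, a map `F X ⟶ Y` is one exactly when its adjoint is. The derived equivalence follows
formally, with functorial cofibrant replacement on the side of `F` and no replacement on the side of
`U` (`exists_derived_adjoint_equivalence`). -/

open scoped ZeroObject

/-! ### Recognition of cofibrantly generated model categories -/

namespace CategoryTheory.MorphismProperty

section SmallObject

variable {C : Type*} [Category.{v} C]

attribute [local instance] Cardinal.fact_isRegular_aleph0 Cardinal.orderBotAleph0OrdToType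

/-- Sets of morphisms with finitely presentable domains permit the small object argument. -/
theorem hasSmallObjectArgument_of_isFinitelyPresentable (S : MorphismProperty C)
    [IsSmall.{w} S] [LocallySmall.{w} C] [HasColimitsOfSize.{w, w} C]
    (hS : ∀ ⦃A B : C⦄ (f : A ⟶ B), S f → IsFinitelyPresentable.{w} A) :
    HasSmallObjectArgument.{w} S :=
  ⟨.aleph0, inferInstance, inferInstance,
    { preservesColimit := fun {A B X Y} i hi f hf => by
        have := hS i hi
        infer_instance }⟩

theorem isSmallRelative_of_isFinitelyPresentable (A : C) [IsFinitelyPresentable.{w} A]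
    (D : MorphismProperty C) : IsSmallRelative.{w} A D :=
  -- The cardinal `0` suffices: a linear order with a least element is already filtered, so the
  -- boundedness condition is not needed.
  ⟨0, fun _ _ _ _ _ _ _ _ _ _ _ => inferInstance⟩

end SmallObject

variable {C : Type*} [Category.{v} C] {S T W : MorphismProperty C}

theorem rlp_llp_le_rlp_llp_of_eq_inf (hST : S.rlp = T.rlp ⊓ W) : T.rlp.llp ≤ S.rlp.llp :=
  antitone_llp (hST.trans_le inf_le_left)

/-- The retract argument. Factor `i` through a `T`-cofibration followed by a `T`-fibration `p`;
two-out-of-three puts `p` in `W`, hence in `S.rlp`, and a lift of `i` against `p` makes `i` a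
retract of the first factor. -/
theorem rlp_llp_inf_eq [W.HasTwoOutOfThreeProperty]
    [HasFunctorialFactorization T.rlp.llp T.rlp]
    (hST : S.rlp = T.rlp ⊓ W) (hT : T.rlp.llp ≤ W) :
    S.rlp.llp ⊓ W = T.rlp.llp := by
  refine le_antisymm ?_ (le_inf (rlp_llp_le_rlp_llp_of_eq_inf hST) hT)
  rintro A B i ⟨hi, hW⟩
  have h := factorizationData T.rlp.llp T.rlp i
  have hp : S.rlp h.p := by
    rw [hST]
    exact ⟨h.hp, W.of_precomp h.i h.p (hT _ h.hi) (by rwa [h.fac])⟩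
  have := hi _ hp
  exact of_retract (RetractArrow.ofLeftLiftingProperty h.fac) h.hi

variable (S T W) in
/-- The model structure with weak equivalences `W`, generating cofibrations `S` and generating
trivial cofibrations `T`. -/
abbrev modelCategoryOfGenerators [HasFiniteLimits C] [HasFiniteColimits C]
    [W.HasTwoOutOfThreeProperty]
    [HasFunctorialFactorization S.rlp.llp S.rlp] [HasFunctorialFactorization T.rlp.llp T.rlp]
    (hST : S.rlp = T.rlp ⊓ W) (hT : T.rlp.llp ≤ W) : ModelCategory C :=
  letI : CategoryWithFibrations C := ⟨T.rlp⟩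
  letI : CategoryWithCofibrations C := ⟨S.rlp.llp⟩
  letI : CategoryWithWeakEquivalences C := ⟨W⟩
  have h₁ : fibrations C = T.rlp := rfl
  have h₂ : trivialFibrations C = S.rlp := hST.symm
  have h₃ : trivialCofibrations C = T.rlp.llp := rlp_llp_inf_eq (S := S) (W := W) hST hT
  have h₄ : cofibrations C = S.rlp.llp := rfl
  have h₅ : weakEquivalences C = W := rfl
  haveI : (weakEquivalences C).HasTwoOutOfThreeProperty :=
    h₅ ▸ ‹W.HasTwoOutOfThreeProperty›
  haveI : IsWeakFactorizationSystem (cofibrations C) (trivialFibrations C) := by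
    rw [h₂, h₄]
    exact { rlp := rlp_llp_rlp S, llp := rfl }
  haveI : IsWeakFactorizationSystem (trivialCofibrations C) (fibrations C) := by
    rw [h₁, h₃]
    exact { rlp := rlp_llp_rlp T, llp := rfl }
  ModelCategory.mk' C

section

variable [HasFiniteLimits C] [HasFiniteColimits C] [W.HasTwoOutOfThreeProperty]
    [HasFunctorialFactorization S.rlp.llp S.rlp] [HasFunctorialFactorization T.rlp.llp T.rlp]
    (hST : S.rlp = T.rlp ⊓ W) (hT : T.rlp.llp ≤ W)

theorem fibrations_modelCategoryOfGenerators :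
    letI := modelCategoryOfGenerators S T W hST hT
    fibrations C = T.rlp := rfl

theorem cofibrations_modelCategoryOfGenerators :
    letI := modelCategoryOfGenerators S T W hST hT
    cofibrations C = S.rlp.llp := rfl

theorem trivialFibrations_modelCategoryOfGenerators :
    letI := modelCategoryOfGenerators S T W hST hT
    trivialFibrations C = S.rlp := hST.symm

theorem trivialCofibrations_modelCategoryOfGenerators :
    letI := modelCategoryOfGenerators S T W hST hT
    trivialCofibrations C = T.rlp.llp := rlp_llp_inf_eq (S := S) (W := W) hST hT

theorem isBicompleteFunctorial_modelCategoryOfGenerators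
    [HasLimitsOfSize.{w, w} C] [HasColimitsOfSize.{w, w} C] :
    letI := modelCategoryOfGenerators S T W hST hT
    IsBicompleteFunctorial.{w} C :=
  letI := modelCategoryOfGenerators S T W hST hT
  { hasLimits := inferInstance
    hasColimits := inferInstance
    functorial_cof_trivFib := by
      rw [cofibrations_modelCategoryOfGenerators hST hT,
        trivialFibrations_modelCategoryOfGenerators hST hT]
      infer_instance
    functorial_trivCof_fib := by
      rw [trivialCofibrations_modelCategoryOfGenerators hST hT,
        fibrations_modelCategoryOfGenerators hST hT]
      infer_instance }

theorem isCofibrantlyGenerated_modelCategoryOfGenerators [IsSmall.{w} S] [IsSmall.{w} T]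
    (hS₁ : ∀ ⦃A B : C⦄ (f : A ⟶ B), S f → IsFinitelyPresentable.{w} A)
    (hT₁ : ∀ ⦃A B : C⦄ (f : A ⟶ B), T f → IsFinitelyPresentable.{w} A) :
    letI := modelCategoryOfGenerators S T W hST hT
    IsCofibrantlyGenerated.{w} C :=
  ⟨S, T, inferInstance, inferInstance,
    fun _ _ f hf => haveI := hS₁ f hf; isSmallRelative_of_isFinitelyPresentable _ _,
    fun _ _ f hf => haveI := hT₁ f hf; isSmallRelative_of_isFinitelyPresentable _ _,
    fibrations_modelCategoryOfGenerators hST hT,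
    trivialFibrations_modelCategoryOfGenerators hST hT⟩

end

end CategoryTheory.MorphismProperty

/-! ### Derived functors from functorial resolutions -/

namespace CategoryTheory

section LeftDerived

variable {C D E : Type*} [Category* C] [Category* D] [Category* E]
  {L : C ⥤ D} (W : MorphismProperty C) [L.IsLocalization W]
  {R : C ⥤ C} (q : R ⟶ 𝟭 C) (hq : ∀ X, W (q.app X))
  {F : C ⥤ E} {LF : D ⥤ E} (α : L ⋙ LF ⟶ F)

include hq in
/-- A natural transformation `α : L ⋙ LF ⟶ F` which is an isomorphism on functorial resolutions
exhibits `LF` as a left derived functor of `F`. -/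
theorem Functor.isLeftDerivedFunctor_of_resolution (hα : ∀ X, IsIso (α.app (R.obj X))) :
    LF.IsLeftDerivedFunctor α W where
  isRightKanExtension := by
    have hL (X : C) : IsIso (L.map (q.app X)) := Localization.inverts L W _ (hq X)
    -- Uniqueness: naturality along the inverted map `q.app X` reduces to resolved objects, where
    -- `α` can be cancelled.
    have key (G : D ⥤ E) {τ τ' : L ⋙ G ⟶ L ⋙ LF} (h : τ ≫ α = τ' ≫ α) : τ = τ' := by
      ext X
      have h₁ := τ.naturality (q.app X)
      have h₂ := τ'.naturality (q.app X)
      have h₃ : τ.app (R.obj X) = τ'.app (R.obj X) := by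
        rw [← cancel_mono (α.app (R.obj X))]
        exact NatTrans.congr_app h (R.obj X)
      have : IsIso ((L ⋙ G).map (q.app X)) := by dsimp; infer_instance
      rw [h₃, ← h₂] at h₁
      exact (cancel_epi ((L ⋙ G).map (q.app X))).1 h₁
    -- Existence: the value at `X` is forced by going back along `q.app X`, inverting `α` at `R X`,
    -- and returning.
    let lift (G : D ⥤ E) (β : L ⋙ G ⟶ F) : L ⋙ G ⟶ L ⋙ LF :=
      { app := fun X => CategoryTheory.inv (G.map (L.map (q.app X))) ≫ β.app (R.obj X) ≫
          CategoryTheory.inv (α.app (R.obj X)) ≫ LF.map (L.map (q.app X))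
        naturality := fun X Y f => by
          have h₁ := β.naturality (R.map f)
          have h₂ := α.naturality (R.map f)
          have h₃ := q.naturality f
          dsimp at h₁ h₂ h₃ ⊢
          rw [← cancel_epi (G.map (L.map (q.app X)))]
          simp only [Category.assoc, IsIso.hom_inv_id_assoc]
          rw [← Functor.map_comp_assoc, ← Functor.map_comp, ← h₃, Functor.map_comp,
            Functor.map_comp, Category.assoc, IsIso.hom_inv_id_assoc, reassoc_of% h₁,
            ← Functor.map_comp, ← Functor.map_comp, ← h₃, Functor.map_comp, Functor.map_comp]
          congr 1
          rw [IsIso.eq_inv_comp, ← reassoc_of% h₂, IsIso.hom_inv_id_assoc] }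
    have hlift (G : D ⥤ E) (β : L ⋙ G ⟶ F) : lift G β ≫ α = β := by
      ext X
      have h₁ := β.naturality (q.app X)
      have h₂ := α.naturality (q.app X)
      dsimp [lift] at h₁ h₂ ⊢
      simp only [Category.assoc]
      rw [h₂, IsIso.inv_hom_id_assoc, ← h₁, IsIso.inv_hom_id_assoc]
    -- Precomposition with a localization functor is fully faithful, so transformations out of `L ⋙
    -- G` descend uniquely to `G`.
    have := Localization.full_whiskeringLeft L W E
    have := Localization.faithful_whiskeringLeft L W E
    refine ⟨⟨IsTerminal.ofUniqueHom (fun G => CostructuredArrow.homMk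
      (((Functor.whiskeringLeft C D E).obj L).preimage (lift G.left G.hom)) ?_) ?_⟩⟩
    · have := hlift G.left G.hom
      refine Eq.trans ?_ this
      congr 1
      exact ((Functor.whiskeringLeft C D E).obj L).map_preimage _
    · intro G m
      ext1
      apply ((Functor.whiskeringLeft C D E).obj L).map_injective
      apply key
      refine (CostructuredArrow.w m).trans ?_
      refine (hlift G.left G.hom).symm.trans ?_
      congr 1
      exact (((Functor.whiskeringLeft C D E).obj L).map_preimage _).symm

end LeftDerived

/-! ### Derived adjunctions and equivalences. -/

section DerivedAdjunction

variable {C₁ C₂ : Type*} [Category* C₁] [Category* C₂] {F : C₁ ⥤ C₂} {U : C₂ ⥤ C₁}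
  (adj : F ⊣ U) {W₁ : MorphismProperty C₁} {W₂ : MorphismProperty C₂}
  {R : C₁ ⥤ C₁} (q : R ⟶ 𝟭 C₁) (hq : ∀ X, W₁ (q.app X))
  (P : ObjectProperty C₁) (hR : ∀ X, P (R.obj X))
  (hF : ∀ ⦃X Y : C₁⦄ (f : X ⟶ Y), P X → P Y → W₁ f → W₂ (F.map f))
  (hU : ∀ ⦃X Y : C₂⦄ (f : X ⟶ Y), W₂ f → W₁ (U.map f))
  (hFU : ∀ ⦃X : C₁⦄ ⦃Y : C₂⦄ (f : F.obj X ⟶ Y), P X → W₁ (adj.homEquiv X Y f) → W₂ f)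
  (hη : ∀ ⦃X : C₁⦄, P X → W₁ (adj.unit.app X))

include hq hR hF hU hFU hη in
/-- The derived adjunction of an adjunction `F ⊣ U` such that `U` preserves weak equivalences and
`F` preserves weak equivalences between the objects satisfying `P`, assuming that the unit is a
weak equivalence on these objects and that the adjoint `F X ⟶ Y` of a weak equivalence `X ⟶ U Y`
is a weak equivalence when `X` satisfies `P`. -/
theorem exists_derived_adjoint_equivalence [W₁.RespectsIso] [W₁.IsMultiplicative]
    [W₁.HasTwoOutOfThreeProperty] :
    ∃ (LF : W₁.Localization ⥤ W₂.Localization) (RU : W₂.Localization ⥤ W₁.Localization)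
      (α : W₁.Q ⋙ LF ⟶ F ⋙ W₂.Q) (β : U ⋙ W₁.Q ⟶ W₂.Q ⋙ RU) (adj' : LF ⊣ RU),
      LF.IsLeftDerivedFunctor α W₁ ∧ (∀ X, P X → IsIso (α.app X)) ∧
      RU.IsRightDerivedFunctor β W₂ ∧ (∀ Y, IsIso (β.app Y)) ∧
      (∀ X, adj'.unit.app (W₁.Q.obj X) ≫ RU.map (α.app X) =
        W₁.Q.map (adj.unit.app X) ≫ β.app (F.obj X)) ∧
      (∀ Y, LF.map (β.app Y) ≫ adj'.counit.app (W₂.Q.obj Y) =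
        α.app (U.obj Y) ≫ W₂.Q.map (adj.counit.app Y)) ∧
      IsIso adj'.unit ∧ IsIso adj'.counit := by
  -- By two-out-of-three `R` preserves `W₁`; it lands in `P`, where `F` preserves weak equivalences.
  have hRF : W₁.IsInvertedBy (R ⋙ F ⋙ W₂.Q) := fun X Y f hf => by
    have h : W₁ (R.map f) := by
      have h₁ : W₁ (R.map f ≫ q.app Y) := by
        rw [q.naturality]
        exact W₁.comp_mem _ _ (hq X) hf
      exact W₁.of_postcomp _ _ (hq Y) h₁
    exact Localization.inverts W₂.Q W₂ _ (hF _ (hR X) (hR Y) h)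
  have hUQ : W₂.IsInvertedBy (U ⋙ W₁.Q) := fun X Y f hf =>
    Localization.inverts W₁.Q W₁ _ (hU f hf)
  let LF := Localization.lift (R ⋙ F ⋙ W₂.Q) hRF W₁.Q
  let RU := Localization.lift (U ⋙ W₁.Q) hUQ W₂.Q
  let α : W₁.Q ⋙ LF ⟶ F ⋙ W₂.Q :=
    (Localization.fac (R ⋙ F ⋙ W₂.Q) hRF W₁.Q).hom ≫ Functor.whiskerRight q (F ⋙ W₂.Q)
  let e := (Localization.fac (U ⋙ W₁.Q) hUQ W₂.Q).symm
  let β : U ⋙ W₁.Q ⟶ W₂.Q ⋙ RU := e.hom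
  have hα (X : C₁) (hX : P X) : IsIso (α.app X) := by
    have : IsIso (W₂.Q.map (F.map (q.app X))) :=
      Localization.inverts W₂.Q W₂ _ (hF _ (hR X) hX (hq X))
    have : IsIso ((Functor.whiskerRight q (F ⋙ W₂.Q)).app X) := this
    dsimp only [α]
    rw [NatTrans.comp_app]
    infer_instance
  have hβ (Y : C₂) : IsIso (β.app Y) := by dsimp only [β]; infer_instance
  have hαR (X : C₁) : IsIso (α.app (R.obj X)) := hα _ (hR X)
  have : LF.IsLeftDerivedFunctor α W₁ :=
    Functor.isLeftDerivedFunctor_of_resolution W₁ q hq α hαR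
  have : RU.IsRightDerivedFunctor β W₂ := Functor.isRightDerivedFunctor_of_inverts W₂ RU e.symm
  -- `Adjunction.derived` characterizes the unit and counit by the universal properties of the two
  -- composites, so these must be derived functors as well.
  have : (LF ⋙ RU).IsLeftDerivedFunctor
      ((Functor.associator _ _ _).inv ≫ Functor.whiskerRight α RU) W₁ :=
    Functor.isLeftDerivedFunctor_of_resolution W₁ q hq _ (fun X => by
      dsimp
      rw [Category.id_comp]
      infer_instance)
  have : (RU ⋙ LF).IsRightDerivedFunctor
      (Functor.whiskerRight β LF ≫ (Functor.associator _ _ _).hom) W₂ :=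
    Functor.isRightDerivedFunctor_of_inverts W₂ (RU ⋙ LF)
      ((Functor.associator _ _ _).symm ≪≫ Functor.isoWhiskerRight e.symm LF)
  let adj' := adj.derived W₁ W₂ α β
  have h₁ (X : C₁) : adj'.unit.app (W₁.Q.obj X) ≫ RU.map (α.app X) =
      W₁.Q.map (adj.unit.app X) ≫ β.app (F.obj X) := adj.derivedη_fac_app W₁ α β X
  have h₂ (Y : C₂) : LF.map (β.app Y) ≫ adj'.counit.app (W₂.Q.obj Y) =
      α.app (U.obj Y) ≫ W₂.Q.map (adj.counit.app Y) := adj.derivedε_fac_app W₂ α β Y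
  have hW₁ {X Y : C₁} (f : X ⟶ Y) (hf : W₁ f) : IsIso (W₁.Q.map f) :=
    Localization.inverts W₁.Q W₁ f hf
  -- On `R X` the unit of `adj` is inverted and so are `α` and `β`; the general case is transported
  -- along the isomorphism induced by `q.app X`.
  have hunit (X : C₁) : IsIso (adj'.unit.app (W₁.Q.obj X)) := by
    have : IsIso (adj'.unit.app (W₁.Q.obj (R.obj X))) := by
      have := hW₁ _ (hη (hR X))
      have h : IsIso (adj'.unit.app (W₁.Q.obj (R.obj X)) ≫ RU.map (α.app (R.obj X))) := by
        rw [h₁]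
        infer_instance
      exact IsIso.of_isIso_comp_right _ (RU.map (α.app (R.obj X)))
    have h := hW₁ _ (hq X)
    exact (NatTrans.isIso_app_iff_of_iso adj'.unit (asIso (W₁.Q.map (q.app X)))).1 this
  have hcounit (Y : C₂) : IsIso (adj'.counit.app (W₂.Q.obj Y)) := by
    have := hW₁ _ (hq (U.obj Y))
    -- Up to the isomorphism `α` at `R (U Y)`, this composite is the image of the map `F R U Y ⟶ Y`
    -- adjoint to the resolution `q.app (U.obj Y)`, to which `hFU` applies.
    have h : IsIso (LF.map (W₁.Q.map (q.app (U.obj Y))) ≫ LF.map (β.app Y) ≫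
        adj'.counit.app (W₂.Q.obj Y)) := by
      have h₃ := α.naturality (q.app (U.obj Y))
      dsimp at h₃
      rw [h₂, reassoc_of% h₃, ← Functor.map_comp]
      have : IsIso (W₂.Q.map (F.map (q.app (U.obj Y)) ≫ adj.counit.app Y)) := by
        apply Localization.inverts W₂.Q W₂
        refine hFU _ (hR _) ?_
        have : F.map (q.app (U.obj Y)) ≫ adj.counit.app Y =
          (adj.homEquiv _ _).symm (q.app (U.obj Y)) := (adj.homEquiv_counit _ _ _).symm
        rw [this]
        exact (Equiv.apply_symm_apply (adj.homEquiv _ _) (q.app (U.obj Y))).symm ▸ hq (U.obj Y)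
      infer_instance
    have h' := IsIso.of_isIso_comp_left (LF.map (W₁.Q.map (q.app (U.obj Y)))) (LF.map (β.app Y) ≫
        adj'.counit.app (W₂.Q.obj Y))
    exact IsIso.of_isIso_comp_left (LF.map (β.app Y)) _
  refine ⟨LF, RU, α, β, adj', inferInstance, hα, inferInstance, hβ, h₁, h₂, ?_, ?_⟩
  · have := Localization.essSurj W₁.Q W₁
    rw [NatTrans.isIso_iff_isIso_app]
    intro X
    rw [NatTrans.isIso_app_iff_of_iso adj'.unit (W₁.Q.objObjPreimageIso X).symm]
    exact hunit _
  · have := Localization.essSurj W₂.Q W₂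
    rw [NatTrans.isIso_iff_isIso_app]
    intro X
    rw [NatTrans.isIso_app_iff_of_iso adj'.counit (W₂.Q.objObjPreimageIso X).symm]
    exact hcounit _

end DerivedAdjunction

end CategoryTheory

/-! ### Finite presentability in terms of morphisms. -/

/-- An object is finitely presentable if the morphisms from it to filtered colimits factor through
some stage, and two such factorizations through a stage agree at a later stage. -/
theorem CategoryTheory.IsFinitelyPresentable.of_exists_hom {C : Type*} [Category.{v} C] (X : C)
    (h₁ : ∀ (J : Type w) [SmallCategory J] [IsFiltered J] (K : J ⥤ C) (c : Cocone K)
      (_ : IsColimit c) (f : X ⟶ c.pt), ∃ (j : J) (p : X ⟶ K.obj j), p ≫ c.ι.app j = f)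
    (h₂ : ∀ (J : Type w) [SmallCategory J] [IsFiltered J] (K : J ⥤ C) (c : Cocone K)
      (_ : IsColimit c) (j : J) (f g : X ⟶ K.obj j), f ≫ c.ι.app j = g ≫ c.ι.app j →
        ∃ (k : J) (u : j ⟶ k), f ≫ K.map u = g ≫ K.map u) :
    IsFinitelyPresentable.{w} X := by
  rw [isFinitelyPresentable_iff_preservesFilteredColimitsOfSize]
  refine ⟨fun J _ _ => ⟨fun {K} => ⟨fun {c} hc => ⟨?_⟩⟩⟩⟩
  refine Types.FilteredColimit.isColimitOf' _ _ (fun f => ?_) (fun j f g h => ?_)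
  · obtain ⟨j, p, hp⟩ := h₁ J K c hc f
    exact ⟨j, p, hp.symm⟩
  · exact h₂ J K c hc j f g h

theorem CategoryTheory.IsFinitelyPresentable.exists_eq_of_isColimit_same {C : Type*}
    [Category.{v} C] {J : Type w} [SmallCategory J] [IsFiltered J] {K : J ⥤ C} {c : Cocone K}
    (hc : IsColimit c) {X : C} [IsFinitelyPresentable.{w} X] {j : J} (f g : X ⟶ K.obj j)
    (h : f ≫ c.ι.app j = g ≫ c.ι.app j) : ∃ (k : J) (u : j ⟶ k), f ≫ K.map u = g ≫ K.map u :=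
  (Types.FilteredColimit.isColimit_eq_iff' (isColimitOfPreserves
    (coyoneda.obj (Opposite.op X)) hc) f g).1 h

/-! ### Disks and spheres -/

namespace ChainComplex

section Disks

variable {A : Type*} [Category.{v} A] [Preadditive A] [HasZeroObject A]

theorem int_rel (n : ℤ) : (ComplexShape.down ℤ).Rel (n + 1) n := rfl

theorem int_succ_ne (n : ℤ) : n + 1 ≠ n := by omega

/-- The disk `P = P` concentrated in the degrees `n + 1` and `n`. -/
noncomputable abbrev disk (P : A) (n : ℤ) : ChainComplex A ℤ :=
  HomologicalComplex.double (𝟙 P) (int_rel n)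

/-- The sphere: the complex `P` concentrated in degree `n`. -/
noncomputable abbrev sphere (P : A) (n : ℤ) : ChainComplex A ℤ :=
  (HomologicalComplex.single A (ComplexShape.down ℤ) n).obj P

/-- The inclusion of the sphere of degree `n` into the disk of degrees `n + 1` and `n`. -/
noncomputable def sphereToDisk (P : A) (n : ℤ) : sphere P n ⟶ disk P n :=
  HomologicalComplex.mkHomFromSingle
    (HomologicalComplex.doubleXIso₁ (𝟙 P) (int_rel n) (int_succ_ne n)).inv
    (fun j _ => by rw [HomologicalComplex.double_d_eq_zero₀ _ _ _ _ (int_succ_ne n).symm, comp_zero])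

/-- The generating trivial cofibrations `0 ⟶ disk P n`. -/
def diskInclusions (P : A) : MorphismProperty (ChainComplex A ℤ) :=
  MorphismProperty.ofHoms (fun n : ℤ => (0 : (0 : ChainComplex A ℤ) ⟶ disk P n))

/-- The generating cofibrations `sphere P n ⟶ disk P n`. -/
def sphereInclusions (P : A) : MorphismProperty (ChainComplex A ℤ) :=
  MorphismProperty.ofHoms (sphereToDisk P)

instance (P : A) : MorphismProperty.IsSmall.{w} (diskInclusions P) :=
  MorphismProperty.isSmall_ofHoms _

instance (P : A) : MorphismProperty.IsSmall.{w} (sphereInclusions P) :=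
  MorphismProperty.isSmall_ofHoms _

/-- Morphisms out of a disk. -/
noncomputable def diskDesc {P : A} {n : ℤ} {V : ChainComplex A ℤ} (γ : P ⟶ V.X (n + 1)) :
    disk P n ⟶ V :=
  HomologicalComplex.mkHomFromDouble _ (int_succ_ne n) γ (γ ≫ V.d (n + 1) n) (by simp) (by simp)

theorem diskDesc_f {P : A} {n : ℤ} {V : ChainComplex A ℤ} (γ : P ⟶ V.X (n + 1)) :
    (diskDesc γ).f (n + 1) =
      (HomologicalComplex.doubleXIso₀ (𝟙 P) (int_rel n)).hom ≫ γ := by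
  simp [diskDesc]

theorem diskDesc_f' {P : A} {n : ℤ} {V : ChainComplex A ℤ} (γ : P ⟶ V.X (n + 1)) :
    (diskDesc γ).f n =
      (HomologicalComplex.doubleXIso₁ (𝟙 P) (int_rel n) (int_succ_ne n)).hom ≫
        γ ≫ V.d (n + 1) n := by
  simp [diskDesc]

/-- The only nonzero differential of a disk is an isomorphism, so the top component determines the
bottom one. -/
theorem disk_hom_ext {P : A} {n : ℤ} {V : ChainComplex A ℤ} {f g : disk P n ⟶ V}
    (h : f.f (n + 1) = g.f (n + 1)) : f = g := by
  refine HomologicalComplex.from_double_hom_ext h ?_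
  have h₁ := f.comm (n + 1) n
  have h₂ := g.comm (n + 1) n
  rw [h, h₂, HomologicalComplex.double_d _ _ (int_succ_ne n)] at h₁
  simpa using h₁.symm

theorem diskDesc_comp {P : A} {n : ℤ} {V W : ChainComplex A ℤ} (γ : P ⟶ V.X (n + 1))
    (f : V ⟶ W) : diskDesc γ ≫ f = diskDesc (γ ≫ f.f (n + 1)) :=
  disk_hom_ext (by simp [diskDesc_f])

theorem eq_diskDesc {P : A} {n : ℤ} {V : ChainComplex A ℤ} (f : disk P n ⟶ V) :
    f = diskDesc ((HomologicalComplex.doubleXIso₀ (𝟙 P) (int_rel n)).inv ≫ f.f (n + 1)) :=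
  disk_hom_ext (by simp [diskDesc_f])

theorem diskDesc_injective {P : A} {n : ℤ} {V : ChainComplex A ℤ} {γ γ' : P ⟶ V.X (n + 1)}
    (h : diskDesc γ = diskDesc γ') : γ = γ' := by
  have := HomologicalComplex.congr_hom h (n + 1)
  rwa [diskDesc_f, diskDesc_f, cancel_epi] at this

/-- Morphisms out of a sphere. -/
noncomputable def sphereDesc {P : A} {n : ℤ} {V : ChainComplex A ℤ} (α : P ⟶ V.X n)
    (hα : ∀ m, α ≫ V.d n m = 0) : sphere P n ⟶ V :=
  HomologicalComplex.mkHomFromSingle α (fun m _ => hα m)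

theorem sphereDesc_f {P : A} {n : ℤ} {V : ChainComplex A ℤ} (α : P ⟶ V.X n)
    (hα : ∀ m, α ≫ V.d n m = 0) : (sphereDesc α hα).f n =
      (HomologicalComplex.singleObjXSelf (ComplexShape.down ℤ) n P).hom ≫ α := by
  simp [sphereDesc]

theorem exists_eq_sphereDesc {P : A} {n : ℤ} {V : ChainComplex A ℤ} (f : sphere P n ⟶ V) :
    ∃ (α : P ⟶ V.X n) (hα : ∀ m, α ≫ V.d n m = 0), f = sphereDesc α hα := by
  refine ⟨(HomologicalComplex.singleObjXSelf (ComplexShape.down ℤ) n P).inv ≫ f.f n,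
    fun m => by simp, ?_⟩
  apply HomologicalComplex.from_single_hom_ext
  simp [sphereDesc_f]

theorem sphereToDisk_comp_diskDesc {P : A} {n : ℤ} {V : ChainComplex A ℤ}
    (γ : P ⟶ V.X (n + 1)) :
    sphereToDisk P n ≫ diskDesc γ = sphereDesc (γ ≫ V.d (n + 1) n) (by simp) := by
  apply HomologicalComplex.from_single_hom_ext
  simp [sphereToDisk, sphereDesc_f, diskDesc_f']

theorem sphereDesc_comp {P : A} {n : ℤ} {V W : ChainComplex A ℤ} (α : P ⟶ V.X n)
    (hα : ∀ m, α ≫ V.d n m = 0) (f : V ⟶ W) :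
    sphereDesc α hα ≫ f = sphereDesc (α ≫ f.f n) (fun m => by
      rw [Category.assoc, f.comm, reassoc_of% (hα m), zero_comp]) := by
  apply HomologicalComplex.from_single_hom_ext
  simp [sphereDesc_f]

theorem sphereDesc_injective {P : A} {n : ℤ} {V : ChainComplex A ℤ} {α α' : P ⟶ V.X n}
    {hα : ∀ m, α ≫ V.d n m = 0} {hα' : ∀ m, α' ≫ V.d n m = 0}
    (h : sphereDesc α hα = sphereDesc α' hα') : α = α' := by
  have := HomologicalComplex.congr_hom h n
  rwa [sphereDesc_f, sphereDesc_f, cancel_epi] at this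

/-- A disk in degrees `n + 1` and `n` corepresents `V ↦ Hom(P, V.X (n + 1))`, and over `ℤ` every
degree has the form `n + 1`. -/
theorem rlp_diskInclusions_iff (P : A) {V W : ChainComplex A ℤ} (f : V ⟶ W) :
    (diskInclusions P).rlp f ↔
      ∀ (n : ℤ) (β : P ⟶ W.X n), ∃ γ : P ⟶ V.X n, γ ≫ f.f n = β := by
  constructor
  · intro h n β
    obtain ⟨n, rfl⟩ : ∃ m, n = m + 1 := ⟨n - 1, by omega⟩
    have := h _ ⟨n⟩
    have sq : CommSq (0 : 0 ⟶ V) (0 : (0 : ChainComplex A ℤ) ⟶ disk P n) f (diskDesc β) :=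
      ⟨by simp⟩
    have h₁ := sq.fac_right
    rw [eq_diskDesc sq.lift, diskDesc_comp] at h₁
    exact ⟨_, diskDesc_injective h₁⟩
  · rintro h _ _ _ ⟨n⟩
    refine ⟨fun {a b} sq => ?_⟩
    obtain ⟨γ, hγ⟩ := h _ ((HomologicalComplex.doubleXIso₀ (𝟙 P) (int_rel n)).inv ≫ b.f (n + 1))
    exact ⟨⟨diskDesc γ, (isZero_zero _).eq_of_src _ _, by
      rw [diskDesc_comp, hγ, ← eq_diskDesc]⟩⟩

/-- Spheres corepresent `P`-valued cycles. A lifting square is thus a cycle `α` of `V` together with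
`β` bounding its image in `W`, and a lift is a `γ` bounding `α` and mapping to `β`. -/
theorem rlp_sphereInclusions_iff (P : A) {V W : ChainComplex A ℤ} (f : V ⟶ W) :
    (sphereInclusions P).rlp f ↔
      ∀ (n : ℤ) (α : P ⟶ V.X n) (β : P ⟶ W.X (n + 1)), (∀ m, α ≫ V.d n m = 0) →
        α ≫ f.f n = β ≫ W.d (n + 1) n →
        ∃ γ : P ⟶ V.X (n + 1), γ ≫ V.d (n + 1) n = α ∧ γ ≫ f.f (n + 1) = β := by
  constructor
  · intro h n α β hα hαβ
    have := h _ ⟨n⟩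
    have sq : CommSq (sphereDesc α hα) (sphereToDisk P n) f (diskDesc β) := ⟨by
      rw [sphereToDisk_comp_diskDesc, sphereDesc_comp]
      congr 1⟩
    have h₁ := sq.fac_left
    have h₂ := sq.fac_right
    rw [eq_diskDesc sq.lift] at h₁ h₂
    rw [sphereToDisk_comp_diskDesc] at h₁
    rw [diskDesc_comp] at h₂
    exact ⟨_, sphereDesc_injective h₁, diskDesc_injective h₂⟩
  · rintro h _ _ _ ⟨n⟩
    refine ⟨fun {a b} sq => ?_⟩
    obtain ⟨α, hα, rfl⟩ := exists_eq_sphereDesc a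
    have hw := sq.w
    rw [eq_diskDesc b, sphereToDisk_comp_diskDesc, sphereDesc_comp] at hw
    obtain ⟨γ, h₁, h₂⟩ := h n α _ hα (sphereDesc_injective hw)
    refine ⟨⟨diskDesc γ, ?_, ?_⟩⟩
    · rw [sphereToDisk_comp_diskDesc]
      congr 1
    · rw [diskDesc_comp, h₂, ← eq_diskDesc]

/-- Morphisms out of a disk are null-homotopic. -/
noncomputable def diskHomotopy {P : A} {n : ℤ} {V : ChainComplex A ℤ} (γ : P ⟶ V.X (n + 1)) :
    Homotopy (diskDesc γ) 0 :=
  (Homotopy.ofEq (disk_hom_ext (by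
    rw [Homotopy.nullHomotopicMap_f (int_rel (n + 1)) (int_rel n), diskDesc_f,
      HomologicalComplex.double_d _ _ (int_succ_ne n)]
    simp)) : Homotopy (diskDesc γ) (Homotopy.nullHomotopicMap
      -- The contraction has a single nonzero component, `γ` itself, viewed from the bottom copy of
      -- `P` to `V.X (n + 1)`.
      (fun i j => if h : i = n ∧ j = n + 1 then
        eqToHom (by rw [h.1]) ≫ (HomologicalComplex.doubleXIso₁ (𝟙 P) (int_rel n)
          (int_succ_ne n)).hom ≫ γ ≫ eqToHom (by rw [h.2]) else 0))).trans
    (Homotopy.nullHomotopy _ (fun i j hij => dif_neg (by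
      rintro ⟨rfl, rfl⟩
      exact hij rfl)))

section

variable {J : Type w} [SmallCategory J] [IsFiltered J] [HasColimitsOfShape J A]
  {K : J ⥤ ChainComplex A ℤ} {c : Cocone K} (hc : IsColimit c) {P : A}
  [IsFinitelyPresentable.{w} P] (n : ℤ)

include hc

omit [HasZeroObject A] in
theorem exists_hom_X_of_isColimit (α : P ⟶ c.pt.X n) :
    ∃ (j : J) (β : P ⟶ (K.obj j).X n), β ≫ (c.ι.app j).f n = α :=
  IsFinitelyPresentable.exists_hom_of_isColimit
    (isColimitOfPreserves (HomologicalComplex.eval A (ComplexShape.down ℤ) n) hc) α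

omit [HasZeroObject A] in
theorem exists_eq_X_of_isColimit {j : J} (α β : P ⟶ (K.obj j).X n)
    (h : α ≫ (c.ι.app j).f n = β ≫ (c.ι.app j).f n) :
    ∃ (k : J) (u : j ⟶ k), α ≫ (K.map u).f n = β ≫ (K.map u).f n :=
  IsFinitelyPresentable.exists_eq_of_isColimit_same
    (isColimitOfPreserves (HomologicalComplex.eval A (ComplexShape.down ℤ) n) hc) (j := j) α β h

end

/-- Finitely presentable objects give finitely presentable spheres. -/
theorem isFinitelyPresentable_sphere [HasColimitsOfSize.{w, w} A] (P : A)
    [IsFinitelyPresentable.{w} P] (n : ℤ) : IsFinitelyPresentable.{w} (sphere P n) := by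
  refine IsFinitelyPresentable.of_exists_hom _ ?_ ?_
  · intro J _ _ K c hc f
    obtain ⟨α, hα, rfl⟩ := exists_eq_sphereDesc f
    obtain ⟨j, β, hβ⟩ := exists_hom_X_of_isColimit hc n α
    -- The representative `β` need not be a cycle at stage `j`; its boundary dies in the colimit,
    -- hence at some later stage `k`.
    obtain ⟨k, u, h⟩ := exists_eq_X_of_isColimit hc (n - 1) (β ≫ (K.obj j).d n (n - 1)) 0 (by
      have h₁ := (c.ι.app j).comm n (n - 1)
      dsimp at h₁
      rw [Category.assoc, ← h₁, reassoc_of% hβ, hα, zero_comp])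
    refine ⟨k, sphereDesc (β ≫ (K.map u).f n) (fun m => ?_), ?_⟩
    · by_cases hm : (ComplexShape.down ℤ).Rel n m
      · obtain rfl : m = n - 1 := by
          have : m + 1 = n := hm
          omega
        simpa using h
      · rw [(K.obj k).shape _ _ hm, comp_zero]
    · rw [sphereDesc_comp]
      congr 1
      have h₁ := HomologicalComplex.congr_hom (c.w u) n
      dsimp at h₁
      rw [Category.assoc, h₁, hβ]
  · intro J _ _ K c hc j f g hfg
    obtain ⟨α, hα, rfl⟩ := exists_eq_sphereDesc f
    obtain ⟨β, hβ, rfl⟩ := exists_eq_sphereDesc g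
    rw [sphereDesc_comp, sphereDesc_comp] at hfg
    obtain ⟨k, u, h⟩ := exists_eq_X_of_isColimit hc n α β (sphereDesc_injective hfg)
    refine ⟨k, u, ?_⟩
    rw [sphereDesc_comp, sphereDesc_comp]
    congr 1

theorem isFinitelyPresentable_zero : IsFinitelyPresentable.{w} (0 : ChainComplex A ℤ) := by
  refine IsFinitelyPresentable.of_exists_hom _ ?_ ?_
  · intro J _ _ K c hc f
    exact ⟨IsFiltered.nonempty.some, 0, (isZero_zero _).eq_of_src _ _⟩
  · intro J _ _ K c hc j f g _
    exact ⟨j, 𝟙 j, (isZero_zero _).eq_of_src _ _⟩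

end Disks

end ChainComplex

/-! ### Quasi-isomorphisms of complexes of modules, in terms of elements -/

namespace CategoryTheory.ShortComplex

variable {R : Type*} [Ring R]

/-- The first clause is surjectivity on homology and the second injectivity, with homology realized
as kernel modulo range. The second is phrased with `z` explicit to match lifting problems. -/
theorem moduleCat_quasiIso_iff {S₁ S₂ : ShortComplex (ModuleCat.{v} R)} (φ : S₁ ⟶ S₂) :
    QuasiIso φ ↔
      (∀ y : S₂.X₂, S₂.g y = 0 → ∃ x : S₁.X₂, S₁.g x = 0 ∧ ∃ z : S₂.X₁, y = φ.τ₂ x + S₂.f z) ∧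
      (∀ x : S₁.X₂, S₁.g x = 0 → ∀ z : S₂.X₁, φ.τ₂ x = S₂.f z → ∃ w : S₁.X₁, x = S₁.f w) := by
  have comm₁ (w : S₁.X₁) : S₂.f (φ.τ₁ w) = φ.τ₂ (S₁.f w) := ConcreteCategory.congr_hom φ.comm₁₂ w
  have comm₂ (x : S₁.X₂) : S₂.g (φ.τ₂ x) = φ.τ₃ (S₁.g x) := ConcreteCategory.congr_hom φ.comm₂₃ x
  let k : LinearMap.ker S₁.g.hom →ₗ[R] LinearMap.ker S₂.g.hom :=
    φ.τ₂.hom.restrict (fun x hx => by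
      have hx' : S₁.g x = 0 := hx
      change S₂.g (φ.τ₂ x) = 0
      rw [comm₂, hx', map_zero])
  let h : (LinearMap.ker S₁.g.hom ⧸ LinearMap.range S₁.moduleCatToCycles) →ₗ[R]
      (LinearMap.ker S₂.g.hom ⧸ LinearMap.range S₂.moduleCatToCycles) :=
    Submodule.mapQ _ _ k (by
      rintro _ ⟨w, rfl⟩
      exact ⟨φ.τ₁ w, Subtype.ext (comm₁ w)⟩)
  let data : LeftHomologyMapData φ S₁.moduleCatLeftHomologyData S₂.moduleCatLeftHomologyData :=
    { φK := ModuleCat.ofHom k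
      φH := ModuleCat.ofHom h
      commi := rfl
      commf' := by
        ext w
        exact Subtype.ext (comm₁ w).symm
      commπ := rfl }
  rw [data.quasiIso_iff, ConcreteCategory.isIso_iff_bijective]
  change Function.Bijective h ↔ _
  rw [Function.Bijective, and_comm, ← LinearMap.ker_eq_bot, Submodule.eq_bot_iff]
  refine and_congr ⟨fun hs y hy => ?_, fun hs y => ?_⟩ ⟨fun hi x hx z hz => ?_, fun hi x hx => ?_⟩
  · obtain ⟨x, hx⟩ := hs (Submodule.Quotient.mk ⟨y, hy⟩)
    obtain ⟨⟨x, hx'⟩, rfl⟩ := Submodule.Quotient.mk_surjective _ x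
    obtain ⟨z, hz⟩ := (Submodule.Quotient.eq _).1 hx
    refine ⟨x, hx', -z, ?_⟩
    have : S₂.f z = φ.τ₂ x - y := congrArg Subtype.val hz
    rw [map_neg, this]
    abel
  · obtain ⟨⟨y, hy⟩, rfl⟩ := Submodule.Quotient.mk_surjective _ y
    obtain ⟨x, hx, z, rfl⟩ := hs y hy
    refine ⟨Submodule.Quotient.mk ⟨x, hx⟩, (Submodule.Quotient.eq _).2 ⟨-z, Subtype.ext ?_⟩⟩
    change S₂.f (-z) = φ.τ₂ x - (φ.τ₂ x + S₂.f z)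
    rw [map_neg]
    abel
  · have := hi (Submodule.Quotient.mk ⟨x, hx⟩)
      ((Submodule.Quotient.mk_eq_zero _).2 ⟨z, Subtype.ext hz.symm⟩)
    obtain ⟨w, hw⟩ := (Submodule.Quotient.mk_eq_zero _).1 this
    exact ⟨w, (congrArg Subtype.val hw).symm⟩
  · obtain ⟨⟨x, hx'⟩, rfl⟩ := Submodule.Quotient.mk_surjective _ x
    obtain ⟨z, hz⟩ := (Submodule.Quotient.mk_eq_zero _).1 hx
    obtain ⟨w, rfl⟩ := hi x hx' z (congrArg Subtype.val hz).symm
    exact (Submodule.Quotient.mk_eq_zero _).2 ⟨w, rfl⟩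

end CategoryTheory.ShortComplex

namespace ChainComplex

theorem moduleCat_quasiIso_iff {R : Type*} [Ring R] {M N : ChainComplex (ModuleCat.{v} R) ℤ}
    (f : M ⟶ N) :
    QuasiIso f ↔ ∀ n : ℤ,
      (∀ y : N.X n, N.d n (n - 1) y = 0 → ∃ x : M.X n, M.d n (n - 1) x = 0 ∧
        ∃ z : N.X (n + 1), y = f.f n x + N.d (n + 1) n z) ∧
      (∀ x : M.X n, M.d n (n - 1) x = 0 → ∀ z : N.X (n + 1), f.f n x = N.d (n + 1) n z →
        ∃ w : M.X (n + 1), x = M.d (n + 1) n w) := by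
  rw [quasiIso_iff]
  refine forall_congr' fun n => ?_
  rw [quasiIsoAt_iff' f (n + 1) n (n - 1) ((ComplexShape.down ℤ).prev_eq' rfl)
    ((ComplexShape.down ℤ).next_eq' (by simp)), ShortComplex.moduleCat_quasiIso_iff]
  rfl

/-- The right-hand side is the lifting problem for `sphere ⟶ disk` written in elements, so this is
the usual description of trivial fibrations. -/
theorem moduleCat_surjective_and_quasiIso_iff {R : Type*} [Ring R]
    {M N : ChainComplex (ModuleCat.{v} R) ℤ} (f : M ⟶ N) :
    ((∀ n, Function.Surjective (f.f n).hom) ∧ QuasiIso f) ↔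
      ∀ (n : ℤ) (x : M.X n) (y : N.X (n + 1)), (∀ m, M.d n m x = 0) →
        f.f n x = N.d (n + 1) n y →
        ∃ z : M.X (n + 1), M.d (n + 1) n z = x ∧ f.f (n + 1) z = y := by
  have comm (i j : ℤ) (x : M.X i) : N.d i j (f.f i x) = f.f j (M.d i j x) :=
    ConcreteCategory.congr_hom (f.comm i j) x
  have dM (i j k : ℤ) (x : M.X i) : M.d j k (M.d i j x) = 0 :=
    ConcreteCategory.congr_hom (M.d_comp_d i j k) x
  have dN (i j k : ℤ) (x : N.X i) : N.d j k (N.d i j x) = 0 :=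
    ConcreteCategory.congr_hom (N.d_comp_d i j k) x
  rw [moduleCat_quasiIso_iff]
  constructor
  · rintro ⟨hs, hq⟩ n x y hx hxy
    obtain ⟨x₁, rfl⟩ := (hq n).2 x (hx _) y hxy
    have h₁ : N.d (n + 1) (n + 1 - 1) (y - f.f (n + 1) x₁) = 0 := by
      rw [show n + 1 - 1 = n by omega, map_sub, ← hxy, comm, sub_self]
    obtain ⟨x₂, hx₂, y₂, hy₂⟩ := (hq (n + 1)).1 _ h₁
    obtain ⟨x₃, rfl⟩ := hs _ y₂
    rw [show n + 1 - 1 = n by omega] at hx₂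
    -- `x₁` bounds `x`; the error `y - f x₁` is a cycle, homologous to the image of the cycle `x₂`;
    -- and `x₃` lifts the chain realizing this homology.
    refine ⟨x₁ + x₂ + M.d _ _ x₃, ?_, ?_⟩
    · rw [map_add, map_add, dM, hx₂, add_zero, add_zero]
    · have h₂ : y = f.f (n + 1) x₁ + (y - f.f (n + 1) x₁) := by abel
      rw [h₂, hy₂, map_add, map_add, add_assoc, ← comm]
  · intro h
    -- The case `x = 0` of the lifting property: cycles lift to cycles.
    have hc (n : ℤ) (y : N.X n) (hy : ∀ m, N.d n m y = 0) :
        ∃ x : M.X n, (∀ m, M.d n m x = 0) ∧ f.f n x = y := by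
      obtain ⟨n, rfl⟩ : ∃ m, n = m + 1 := ⟨n - 1, by omega⟩
      obtain ⟨x, hx, rfl⟩ := h n 0 y (fun m => map_zero _) (by rw [map_zero, hy])
      refine ⟨x, fun m => ?_, rfl⟩
      by_cases hm : (ComplexShape.down ℤ).Rel (n + 1) m
      · obtain rfl : m = n := by
          have : m + 1 = n + 1 := hm
          omega
        exact hx
      · rw [M.shape _ _ hm]
        rfl
    refine ⟨fun n y => ?_, fun n => ⟨fun y hy => ?_, fun x hx z hz => ?_⟩⟩
    · obtain ⟨n, rfl⟩ : ∃ m, n = m + 1 := ⟨n - 1, by omega⟩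
      -- For arbitrary `y`, lift its boundary to a cycle first; the lifting property then supplies a
      -- preimage of `y` bounding that cycle.
      obtain ⟨x, hx, hxy⟩ := hc n (N.d (n + 1) n y) (fun m => dN _ _ _ _)
      obtain ⟨z, -, hz⟩ := h n x y hx hxy
      exact ⟨z, hz⟩
    · obtain ⟨x, hx, rfl⟩ := hc n y (fun m => by
        by_cases hm : (ComplexShape.down ℤ).Rel n m
        · obtain rfl : m = n - 1 := by
            have : m + 1 = n := hm
            omega
          exact hy
        · rw [N.shape _ _ hm]
          rfl)
      exact ⟨x, hx _, 0, by rw [map_zero, add_zero]⟩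
    · obtain ⟨w, hw, -⟩ := h n x z (fun m => by
        by_cases hm : (ComplexShape.down ℤ).Rel n m
        · obtain rfl : m = n - 1 := by
            have : m + 1 = n := hm
            omega
          exact hx
        · rw [M.shape _ _ hm]
          rfl) hz
      exact ⟨w, hw.symm⟩

end ChainComplex

/-! ### The projective model structure relative to a corepresentable functor to modules -/

namespace CategoryTheory.Functor

open ChainComplex

variable {A : Type*} [Category.{v} A] [Preadditive A] {R : Type*} [Ring R]
  (U : A ⥤ ModuleCat.{w} R) [U.Additive]

/-- The chain maps which become quasi-isomorphisms after applying `U`. -/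
def quasiIsoInverseImage : MorphismProperty (ChainComplex A ℤ) :=
  (HomologicalComplex.quasiIso (ModuleCat.{w} R) (ComplexShape.down ℤ)).inverseImage
    (U.mapHomologicalComplex (ComplexShape.down ℤ))

instance : U.quasiIsoInverseImage.HasTwoOutOfThreeProperty := by
  unfold quasiIsoInverseImage
  infer_instance

instance : U.quasiIsoInverseImage.IsMultiplicative := by
  unfold quasiIsoInverseImage
  infer_instance

theorem quasiIsoInverseImage_of_homotopyEquiv {V W : ChainComplex A ℤ} (e : HomotopyEquiv V W) :
    U.quasiIsoInverseImage e.hom :=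
  inferInstanceAs (QuasiIso (U.mapHomotopyEquiv e).hom)

/-- If every complex `W` has the property that `W ⟶ 0` and `pathObject W ⟶ W ⨯ W` belong to `Q`,
morphisms with the left lifting property with respect to `Q` are homotopy equivalences. -/
theorem exists_homotopyEquiv_of_llp [HasZeroObject A] [HasBinaryBiproducts A]
    {Q : MorphismProperty (ChainComplex A ℤ)} {V W : ChainComplex A ℤ} (j : V ⟶ W) (hj : Q.llp j)
    (h₀ : Q (0 : V ⟶ 0))
    (h₁ : Q (prod.lift (HomologicalComplex.pathObject.π₀ W)
      (HomologicalComplex.pathObject.π₁ W))) :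
    ∃ e : HomotopyEquiv V W, e.hom = j := by
  have := hj _ h₀
  -- Lifting against `V ⟶ 0` gives a retraction of `j`.
  have sq₀ : CommSq (𝟙 V) j (0 : V ⟶ 0) (0 : W ⟶ 0) := ⟨by simp⟩
  have := hj _ h₁
  -- A lift here is a homotopy between `𝟙 W` and the retraction followed by `j`, constant along `V`.
  have sq₁ : CommSq (j ≫ HomologicalComplex.pathObject.ι W) j
      (prod.lift (HomologicalComplex.pathObject.π₀ W) (HomologicalComplex.pathObject.π₁ W))
      (prod.lift (𝟙 W) (sq₀.lift ≫ j)) := ⟨by ext1 <;> simp⟩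
  have h₂ := sq₁.fac_right
  have h₃ : sq₁.lift ≫ HomologicalComplex.pathObject.π₀ W = 𝟙 W := by
    simpa only [Category.assoc, prod.lift_fst] using congrArg (· ≫ prod.fst) h₂
  have h₄ : sq₁.lift ≫ HomologicalComplex.pathObject.π₁ W = sq₀.lift ≫ j := by
    simpa only [Category.assoc, prod.lift_snd] using congrArg (· ≫ prod.snd) h₂
  exact ⟨{
    hom := j
    inv := sq₀.lift
    homotopyHomInvId := Homotopy.ofEq (by simp)
    homotopyInvHomId := (Homotopy.ofEq h₄.symm).trans
      (((HomologicalComplex.pathObject.homotopy₀₁ W (fun i => ⟨i - 1, by simp⟩)).symm.compLeft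
        sq₁.lift).trans (Homotopy.ofEq h₃)) }, rfl⟩

/-- The path object projection is a fibration because any two maps out of a disk are null-homotopic,
hence homotopic to each other, and a homotopy is exactly a map to the path object. -/
theorem rlp_diskInclusions_llp_le [HasZeroObject A] [HasBinaryBiproducts A]
    (P : A) : (diskInclusions P).rlp.llp ≤ U.quasiIsoInverseImage := by
  intro V W j hj
  obtain ⟨e, rfl⟩ := exists_homotopyEquiv_of_llp j hj
    ((rlp_diskInclusions_iff P _).2 (fun n β => ⟨0, by
      have : IsZero ((0 : ChainComplex A ℤ).X n) :=
        (HomologicalComplex.eval A (ComplexShape.down ℤ) n).map_isZero (isZero_zero _)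
      exact this.eq_of_tgt _ _⟩))
    (by
      rintro _ _ _ ⟨n⟩
      refine ⟨fun {a b} sq => ?_⟩
      have H (f : disk P n ⟶ W) : Homotopy f 0 :=
        (Homotopy.ofEq (eq_diskDesc f)).trans (diskHomotopy _)
      refine ⟨⟨HomologicalComplex.pathObject.lift (b ≫ prod.fst) (b ≫ prod.snd)
        ((H _).trans (H _).symm), (isZero_zero _).eq_of_src _ _, ?_⟩⟩
      ext1 <;> simp [prod.lift_fst, prod.lift_snd])
  exact U.quasiIsoInverseImage_of_homotopyEquiv e

variable {U} {P : A} (e : ∀ V, (P ⟶ V) ≃+ U.obj V)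
  (he : ∀ {V W : A} (g : P ⟶ V) (f : V ⟶ W), e W (g ≫ f) = U.map f (e V g))

include he

theorem rlp_diskInclusions_iff_surjective [HasZeroObject A] {V W : ChainComplex A ℤ} (f : V ⟶ W) :
    (diskInclusions P).rlp f ↔ ∀ n, Function.Surjective
      (((U.mapHomologicalComplex (ComplexShape.down ℤ)).map f).f n).hom := by
  rw [rlp_diskInclusions_iff]
  refine forall_congr' fun n => ⟨fun h (y : U.obj (W.X n)) => ?_, fun h β => ?_⟩
  · obtain ⟨γ, hγ⟩ := h ((e _).symm y)
    refine ⟨e _ γ, ?_⟩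
    have := he γ (f.f n)
    rw [hγ, AddEquiv.apply_symm_apply] at this
    exact this.symm
  · obtain ⟨x, hx⟩ : ∃ x : U.obj (V.X n), U.map (f.f n) x = e _ β := h (e _ β)
    refine ⟨(e _).symm x, (e _).injective ?_⟩
    rw [he, AddEquiv.apply_symm_apply]
    exact hx

theorem rlp_sphereInclusions_iff_surjective_and_quasiIso [HasZeroObject A]
    {V W : ChainComplex A ℤ} (f : V ⟶ W) :
    (sphereInclusions P).rlp f ↔ (∀ n, Function.Surjective
      (((U.mapHomologicalComplex (ComplexShape.down ℤ)).map f).f n).hom) ∧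
        QuasiIso ((U.mapHomologicalComplex (ComplexShape.down ℤ)).map f) := by
  rw [rlp_sphereInclusions_iff, moduleCat_surjective_and_quasiIso_iff]
  have he₀ {X Y : A} (g : P ⟶ X) (a : X ⟶ Y) : g ≫ a = 0 ↔ U.map a (e X g) = 0 := by
    rw [← he, EmbeddingLike.map_eq_zero_iff]
  refine forall_congr' fun n => ⟨fun h (x : U.obj (V.X n)) (y : U.obj (W.X (n + 1))) hx hxy => ?_,
    fun h α β hα hαβ => ?_⟩
  · obtain ⟨γ, h₁, h₂⟩ := h ((e _).symm x) ((e _).symm y)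
      (fun m => by
        rw [he₀, AddEquiv.apply_symm_apply]
        exact hx m)
      ((e _).injective (by
        rw [he, he, AddEquiv.apply_symm_apply, AddEquiv.apply_symm_apply]
        exact hxy))
    refine ⟨e _ γ, ?_, ?_⟩
    · refine (he γ _).symm.trans ?_
      rw [h₁, AddEquiv.apply_symm_apply]
    · refine (he γ _).symm.trans ?_
      rw [h₂, AddEquiv.apply_symm_apply]
  · obtain ⟨z, h₁, h₂⟩ : ∃ z : U.obj (V.X (n + 1)), U.map (V.d (n + 1) n) z = e _ α ∧
        U.map (f.f (n + 1)) z = e _ β := h (e _ α) (e _ β) (fun m => (he₀ α _).1 (hα m))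
      (((he α _).symm.trans (congrArg _ hαβ)).trans (he β _))
    refine ⟨(e _).symm z, (e _).injective ?_, (e _).injective ?_⟩
    · rw [he, AddEquiv.apply_symm_apply]
      exact h₁
    · rw [he, AddEquiv.apply_symm_apply]
      exact h₂

theorem rlp_sphereInclusions_eq [HasZeroObject A] :
    (sphereInclusions P).rlp = (diskInclusions P).rlp ⊓ U.quasiIsoInverseImage := by
  ext V W f
  rw [rlp_sphereInclusions_iff_surjective_and_quasiIso e he]
  exact and_congr_left' (rlp_diskInclusions_iff_surjective e he f).symm

end CategoryTheory.Functor

/-! ### Bicompleteness of complexes and the small object argument. -/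

namespace ChainComplex

theorem hasColimitsOfSize (A : Type*) [Category.{v} A] [Preadditive A]
    [HasColimitsOfSize.{w, w} A] : HasColimitsOfSize.{w, w} (ChainComplex A ℤ) :=
  ⟨fun _ _ => inferInstance⟩

theorem hasLimitsOfSize (A : Type*) [Category.{v} A] [Preadditive A]
    [HasLimitsOfSize.{w, w} A] : HasLimitsOfSize.{w, w} (ChainComplex A ℤ) :=
  ⟨fun _ _ => inferInstance⟩

section

variable {A : Type*} [Category.{v} A] [Preadditive A] [HasZeroObject A]
  (P : A)

theorem isFinitelyPresentable_of_diskInclusions ⦃X Y : ChainComplex A ℤ⦄ (f : X ⟶ Y)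
    (hf : diskInclusions P f) : IsFinitelyPresentable.{v} X := by
  obtain ⟨n⟩ := hf
  exact isFinitelyPresentable_zero

variable [HasColimitsOfSize.{v, v} A]

theorem isFinitelyPresentable_of_sphereInclusions [IsFinitelyPresentable.{v} P]
    ⦃X Y : ChainComplex A ℤ⦄ (f : X ⟶ Y)
    (hf : sphereInclusions P f) : IsFinitelyPresentable.{v} X := by
  obtain ⟨n⟩ := hf
  exact isFinitelyPresentable_sphere P n

instance : MorphismProperty.HasSmallObjectArgument.{v} (diskInclusions P) :=
  have := hasColimitsOfSize.{v} A
  MorphismProperty.hasSmallObjectArgument_of_isFinitelyPresentable _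
    (isFinitelyPresentable_of_diskInclusions P)

instance [IsFinitelyPresentable.{v} P] :
    MorphismProperty.HasSmallObjectArgument.{v} (sphereInclusions P) :=
  have := hasColimitsOfSize.{v} A
  MorphismProperty.hasSmallObjectArgument_of_isFinitelyPresentable _
    (isFinitelyPresentable_of_sphereInclusions P)

end

end ChainComplex

/-! ### Limits and colimits of smooth representations -/

namespace SmoothRep

variable {k G : Type u} [Field k] [Group G] [TopologicalSpace G] [IsTopologicalGroup G]

/-- The stabilizer of `g v` contains the conjugate by `g` of the stabilizer of `v`, which is open.
-/
theorem smoothVectors_le_comap {V : Type*} [AddCommGroup V] [Module k V]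
    (ρ : Representation k G V) (g : G) : ρ.smoothVectors ≤ ρ.smoothVectors.comap (ρ g) := by
  intro v hv
  refine ρ.isOpen_stab_of_le _ ((fun x => g⁻¹ * x * g) ⁻¹' {x : G | ρ x v = v})
    (IsOpen.preimage (by fun_prop) hv) (by simp) ?_
  intro x hx
  have h : ρ (g⁻¹ * x * g) v = v := hx
  calc ρ x (ρ g v) = ρ g (ρ (g⁻¹ * x * g) v) := by
        rw [← Module.End.mul_apply, ← map_mul, ← Module.End.mul_apply, ← map_mul]
        congr 2; group
    _ = ρ g v := by rw [h]

/-- The subrepresentation of smooth vectors. -/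
def smoothPart (V : Rep.{u} k G) : SmoothRep k G :=
  of (V.ρ.subrepresentation V.ρ.smoothVectors (smoothVectors_le_comap V.ρ)) (fun v => by
    have h : IsOpen {g : G | V.ρ g v.1 = v.1} := v.2
    convert h using 3
    exact Subtype.ext_iff)

/-- The morphism to the smooth part given by a morphism from a smooth representation. -/
def liftSmoothPart {V : SmoothRep k G} {W : Rep.{u} k G} (f : V.obj ⟶ W) : V ⟶ smoothPart W :=
  mkHom (W := smoothPart W)
    (f.hom.toLinearMap.codRestrict W.ρ.smoothVectors (fun v =>
      W.ρ.isOpen_stab_of_le _ _ (V.property v) (by simp) (fun g hg =>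
        (LinearMap.congr_fun (f.hom.isIntertwining' g) v).symm.trans (congrArg _ hg))))
    (fun g v => Subtype.ext (LinearMap.congr_fun (f.hom.isIntertwining' g) v))

/-- The inclusion of the smooth part. -/
def smoothPartι (W : Rep.{u} k G) : (smoothPart W).obj ⟶ W :=
  Rep.ofHom ⟨W.ρ.smoothVectors.subtype, fun _ => rfl⟩

variable (k G) in
/-- The inclusion of smooth representations into all representations. -/
abbrev incl : SmoothRep k G ⥤ Rep.{u} k G :=
  ObjectProperty.ι (fun V : Rep.{u} k G => V.ρ.IsSmooth)

/-- This yields all limits and colimits of smooth representations; moreover `incl`, being a left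
adjoint, preserves colimits. -/
noncomputable instance : Coreflective (incl k G) where
  R := Adjunction.rightAdjointOfEquiv (F := incl k G) (G_obj := smoothPart)
    (fun _ W =>
      { toFun := liftSmoothPart
        invFun := fun f => f.hom ≫ smoothPartι W
        left_inv := fun _ => rfl
        right_inv := fun _ => rfl }) (fun _ _ _ _ _ => rfl)
  adj := Adjunction.adjunctionOfEquivRight _ _

theorem hasLimitsOfSize : HasLimitsOfSize.{u, u} (SmoothRep k G) :=
  hasLimits_of_coreflective (incl k G)

theorem hasColimitsOfSize : HasColimitsOfSize.{u, u} (SmoothRep k G) :=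
  hasColimits_of_coreflective (incl k G)

attribute [local instance] hasLimitsOfSize hasColimitsOfSize

instance : HasZeroObject (SmoothRep k G) :=
  hasZeroObject_of_hasTerminal_object

instance : HasBinaryBiproducts (SmoothRep k G) :=
  HasBinaryBiproducts.of_hasBinaryProducts

/-! ### Filtered colimits of smooth representations -/

section

variable {J : Type u} [SmallCategory J] [IsFiltered J] {K : J ⥤ SmoothRep k G} {c : Cocone K}

/-- Colimits are computed in `Rep`, and filtered ones on underlying sets. -/
theorem exists_of_isColimit (hc : IsColimit c) (x : c.pt.obj.V) :
    ∃ (j : J) (y : (K.obj j).obj.V), toLin (c.ι.app j) y = x := by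
  obtain ⟨j, y, hy⟩ := Concrete.isColimit_exists_rep _
    (isColimitOfPreserves (incl k G ⋙ forget₂ (Rep.{u} k G) (ModuleCat.{u} k)) hc) x
  exact ⟨j, y, hy⟩

theorem exists_map_eq_of_isColimit (hc : IsColimit c) {j : J} (x y : (K.obj j).obj.V)
    (h : toLin (c.ι.app j) x = toLin (c.ι.app j) y) :
    ∃ (l : J) (u : j ⟶ l), toLin (K.map u) x = toLin (K.map u) y := by
  obtain ⟨l, u, hu⟩ := (IsColimit.eq_iff' (isColimitOfPreserves
    (incl k G ⋙ forget₂ (Rep.{u} k G) (ModuleCat.{u} k)) hc) x y).1 h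
  exact ⟨l, u, hu⟩

/-- By smoothness and compactness the stabilizer of `x` in `I` has finite index, so invariance
amounts to finitely many equations. Each holds at a later stage, and filteredness provides a common
one. -/
theorem exists_map_mem_invSpace (I : OpenSubgroup G) [CompactSpace I] (hc : IsColimit c) {j : J}
    (x : (K.obj j).obj.V) (h : toLin (c.ι.app j) x ∈ invSpace I c.pt) :
    ∃ (l : J) (u : j ⟶ l), toLin (K.map u) x ∈ invSpace I (K.obj l) := by
  let S : Subgroup I :=
    { carrier := {g | (K.obj j).obj.ρ g x = x}
      mul_mem' := fun {a b} ha hb => by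
        simp only [Set.mem_ofPred_eq] at *
        rw [Subgroup.coe_mul, map_mul, Module.End.mul_apply, hb, ha]
      one_mem' := by simp
      inv_mem' := fun {a} ha => by
        simp only [Set.mem_ofPred_eq] at *
        conv_lhs => rw [← ha]
        simp }
  have hS : IsOpen (S : Set I) := ((K.obj j).property x).preimage continuous_subtype_val
  have : IsTopologicalGroup I := inferInstanceAs (IsTopologicalGroup I.toSubgroup)
  have : Finite (I ⧸ S) := S.quotient_finite_of_isOpen hS
  have h₁ (q : I ⧸ S) : ∃ (l : J) (u : j ⟶ l),
      toLin (K.map u) ((K.obj j).obj.ρ q.out x) = toLin (K.map u) x :=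
    exists_map_eq_of_isColimit hc _ _ ((toLin_comm _ _ _).trans (h _ q.out.2))
  choose l u hu using h₁
  obtain ⟨m, a, b, hm⟩ := IsFiltered.wideSpan u
  refine ⟨m, a, fun i hi => ?_⟩
  -- The chosen coset representative is `i * s` with `s` fixing `x`, so its equation is the one for
  -- `i`.
  obtain ⟨⟨s, hs⟩, hq⟩ := QuotientGroup.mk_out_eq_mul S ⟨i, hi⟩
  have h₂ := hu (QuotientGroup.mk ⟨i, hi⟩)
  rw [hq, Subgroup.coe_mul, map_mul, Module.End.mul_apply, show (K.obj j).obj.ρ s x = x from hs]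
    at h₂
  rw [← toLin_comm, ← hm (QuotientGroup.mk ⟨i, hi⟩), Functor.map_comp]
  exact congrArg (toLin (K.map (b _))) h₂

end

end SmoothRep

/-! ### Finite presentability of `𝕏`. -/

section

variable {k G : Type u} [Field k] [Group G] [TopologicalSpace G] [IsTopologicalGroup G]
  (I : OpenSubgroup G) [CompactSpace I]

/-- Since `Hom(𝕏, V) = V^I`, this says that `I`-invariants commute with filtered colimits. -/
instance isFinitelyPresentable_cInd : IsFinitelyPresentable.{u} (cInd k I) := by
  refine IsFinitelyPresentable.of_exists_hom _ ?_ ?_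
  · intro J _ _ K c hc f
    obtain ⟨j, x, hx⟩ := SmoothRep.exists_of_isColimit hc (frobEquiv I c.pt f).1
    obtain ⟨l, u, hu⟩ := SmoothRep.exists_map_mem_invSpace I hc x
      (hx ▸ (frobEquiv I c.pt f).2)
    refine ⟨l, frobHom ⟨_, hu⟩, cInd_hom_ext ?_⟩
    refine (congrArg (SmoothRep.toLin (c.ι.app l)) (frobHom_oneI _)).trans ?_
    have h₁ : SmoothRep.toLin (K.map u ≫ c.ι.app l) x = SmoothRep.toLin (c.ι.app j) x := by
      rw [c.w]
    exact h₁.trans hx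
  · intro J _ _ K c hc j f g h
    obtain ⟨l, u, hu⟩ := SmoothRep.exists_map_eq_of_isColimit hc
      (SmoothRep.toLin f (oneI k I)) (SmoothRep.toLin g (oneI k I))
      (congrArg (fun a => SmoothRep.toLin a (oneI k I)) h)
    exact ⟨l, u, cInd_hom_ext hu⟩

end

/-! ### Modules -/

section

variable (R : Type u) [Ring R]

instance isFinitelyPresentable_moduleCat_self :
    IsFinitelyPresentable.{u} (ModuleCat.of R R) := by
  refine IsFinitelyPresentable.of_exists_hom _ ?_ ?_
  · intro J _ _ K c hc f
    obtain ⟨j, x, hx⟩ := Concrete.isColimit_exists_rep _ hc (f (1 : R))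
    refine ⟨j, ModuleCat.ofHom (LinearMap.toSpanSingleton R _ x), ?_⟩
    ext
    simpa using hx
  · intro J _ _ K c hc j f g h
    obtain ⟨l, u, hu⟩ := (IsColimit.eq_iff' hc (f (1 : R)) (g (1 : R))).1
      (ConcreteCategory.congr_hom h _)
    refine ⟨l, u, ?_⟩
    ext
    exact hu

/-- A morphism from the free module of rank one is determined by the image of `1`. -/
def moduleCatSelfHomEquiv (M : ModuleCat.{u} R) : (ModuleCat.of R R ⟶ M) ≃+ M :=
  ModuleCat.homAddEquiv.trans (LinearMap.ringLmapEquivSelf R ℕ M).toAddEquiv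

end

/-! ### The unit of `F ⊣ U` on projective modules -/

section

variable {k G : Type u} [Field k] [Group G] [TopologicalSpace G] [IsTopologicalGroup G]
  {I : OpenSubgroup G} [CompactSpace I]

theorem tensorMk_self_eq (x : (cInd k I).obj.V) (h : Hecke k I) :
    tensorMk (M := ModuleCat.of (Hecke k I) (Hecke k I)) x h =
      tensorMk (M := ModuleCat.of (Hecke k I) (Hecke k I)) (SmoothRep.toLin h.unop x)
        (1 : Hecke k I) := by
  rw [tensorMk_balanced]
  exact congrArg (tensorMk _) (mul_one h).symm

/-- The morphism `𝕏 ⊗_H H ⟶ 𝕏`. -/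
noncomputable def tensorSelfHom :
    tensorObj (ModuleCat.of (Hecke k I) (Hecke k I)) ⟶ cInd k I :=
  tensorLift (M := ModuleCat.of (Hecke k I) (Hecke k I))
    { toFun := fun h : Hecke k I => (h.unop : cInd k I ⟶ cInd k I)
      map_zero' := rfl
      map_add' := fun _ _ => rfl } (fun _ _ => rfl)

theorem tensorSelfHom_comp_tensorMkHom :
    tensorSelfHom (k := k) (I := I) ≫
      tensorMkHom (M := ModuleCat.of (Hecke k I) (Hecke k I)) (1 : Hecke k I) = 𝟙 _ :=
  tensorHom_ext fun x h => (tensorMk_self_eq x h).symm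

/-- The unit followed by `(𝕏 ⊗_H H)^I → 𝕏^I` is the Frobenius bijection `End(𝕏) ≃ 𝕏^I`. The second
map is injective, being split by `x ↦ x ⊗ 1`, so both are bijective. -/
theorem unitFU_self_bijective :
    Function.Bijective (unitFU (ModuleCat.of (Hecke k I) (Hecke k I))).hom := by
  have h : ⇑((functorU k I).map (tensorSelfHom (k := k) (I := I))).hom ∘
      (unitFU (ModuleCat.of (Hecke k I) (Hecke k I))).hom =
        fun h : Hecke k I => frobEquiv I (cInd k I) h.unop := rfl
  have h₁ : Function.Injective ((functorU k I).map (tensorSelfHom (k := k) (I := I))).hom := by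
    refine Function.LeftInverse.injective (g := ((functorU k I).map (tensorMkHom
      (M := ModuleCat.of (Hecke k I) (Hecke k I)) (1 : Hecke k I))).hom) (fun x => ?_)
    have := congrArg (fun f => ((functorU k I).map f).hom x)
      (tensorSelfHom_comp_tensorMkHom (k := k) (I := I))
    exact this
  have h₂ : Function.Bijective (fun h : Hecke k I => frobEquiv I (cInd k I) h.unop) :=
    (frobEquiv I (cInd k I)).bijective.comp MulOpposite.unop_bijective
  rw [← h] at h₂
  exact (Function.Bijective.of_comp_iff' (f := ((functorU k I).map tensorSelfHom).hom)
    ⟨h₁, h₂.surjective.of_comp⟩ _).1 h₂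

theorem unitFU_naturality {M N : ModuleCat.{u} (Hecke k I)} (f : M ⟶ N) (m : M) :
    (unitFU N).hom (f m) =
      ((functorU k I).map ((functorF k I).map f)).hom ((unitFU M).hom m) := rfl

theorem unitFU_bijective_of_retract {M N : ModuleCat.{u} (Hecke k I)} (r : Retract M N)
    (h : Function.Bijective (unitFU N).hom) : Function.Bijective (unitFU M).hom := by
  have hr (m : M) : r.r (r.i m) = m := ConcreteCategory.congr_hom r.retract m
  have hr' (z : (functorU k I).obj ((functorF k I).obj M)) :
      ((functorU k I).map ((functorF k I).map r.r)).hom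
        (((functorU k I).map ((functorF k I).map r.i)).hom z) = z := by
    refine ConcreteCategory.congr_hom (C := ModuleCat (Hecke k I)) (?_ :
      (functorU k I).map ((functorF k I).map r.i) ≫
        (functorU k I).map ((functorF k I).map r.r) = 𝟙 _) z
    rw [← Functor.map_comp, ← Functor.map_comp, r.retract, CategoryTheory.Functor.map_id,
      CategoryTheory.Functor.map_id]
  refine ⟨fun m m' hm => ?_, fun z => ?_⟩
  · rw [← hr m, ← hr m']
    congr 1
    apply h.injective
    rw [unitFU_naturality, unitFU_naturality, hm]
  · obtain ⟨w, hw⟩ := h.surjective (((functorU k I).map ((functorF k I).map r.i)).hom z)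
    refine ⟨r.r w, ?_⟩
    rw [unitFU_naturality, hw, hr']

section

variable (k I) (S : Type u)

/-- The free module on `S`. -/
noncomputable abbrev freeHecke : ModuleCat.{u} (Hecke k I) := ModuleCat.of _ (S →₀ Hecke k I)

variable {S}

/-- The projection onto a component. -/
noncomputable def freeHeckeπ (s : S) : freeHecke k I S ⟶ ModuleCat.of (Hecke k I) (Hecke k I) :=
  ModuleCat.ofHom (Finsupp.lapply s)

/-- The inclusion of a component. -/
noncomputable def freeHeckeι (s : S) :
    ModuleCat.of (Hecke k I) (Hecke k I) ⟶ freeHecke k I S :=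
  ModuleCat.ofHom (Finsupp.lsingle s)

variable {k I}

/-- `𝕏 ⊗_H -` of a free module is a direct sum of copies of `𝕏 ⊗_H H`. Allowing every larger `t'`
lets the two finite sets be merged when adding elements. -/
theorem exists_finset_eq_sum_freeHecke (z : (tensorObj (freeHecke k I S)).obj.V) :
    ∃ t : Finset S, ∀ t' : Finset S, t ⊆ t' → z = ∑ s ∈ t',
      SmoothRep.toLin (tensorMap (freeHeckeι k I s))
        (SmoothRep.toLin (tensorMap (freeHeckeπ k I s)) z) := by
  classical
  induction z using tensorObj_induction with
  | h0 => exact ⟨∅, fun t' _ => by simp only [map_zero, Finset.sum_const_zero]⟩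
  | h1 x m =>
    let m' : S →₀ Hecke k I := m
    refine ⟨m'.support, fun t' ht => ?_⟩
    have h : m = ∑ s ∈ t', (freeHeckeι k I s).hom ((freeHeckeπ k I s).hom m) := by
      change m' = ∑ s ∈ t', Finsupp.single s (m' s)
      exact (Finsupp.sum_of_support_subset m' ht _ (by simp)).symm.trans m'.sum_single |>.symm
    have h₁ (a : Finset S) (φ : S → freeHecke k I S) :
        tensorMk x (∑ s ∈ a, φ s) = ∑ s ∈ a, tensorMk x (φ s) :=
      map_sum (AddMonoidHom.mk' (tensorMk (M := freeHecke k I S) x) (tensorMk_add x)) φ a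
    conv_lhs => rw [h, h₁]
    rfl
  | h2 a b ha hb =>
    obtain ⟨t₁, h₁⟩ := ha
    obtain ⟨t₂, h₂⟩ := hb
    refine ⟨t₁ ∪ t₂, fun t' ht => ?_⟩
    simp only [map_add, Finset.sum_add_distrib]
    rw [← h₁ t' (Finset.union_subset_left ht), ← h₂ t' (Finset.union_subset_right ht)]

/-- Reduction to rank one coordinatewise: the projections are equivariant, so the coordinates of an
invariant element are invariant, and only finitely many of them are needed to recover it. -/
theorem unitFU_free_bijective : Function.Bijective (unitFU (freeHecke k I S)).hom := by
  constructor
  · intro m m' h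
    have key (s : S) : (freeHeckeπ k I s).hom m = (freeHeckeπ k I s).hom m' := by
      apply unitFU_self_bijective.injective
      rw [unitFU_naturality, unitFU_naturality, h]
    exact Finsupp.ext key
  · intro z
    let z' : invSpace I (tensorObj (freeHecke k I S)) := z
    obtain ⟨t, ht⟩ := exists_finset_eq_sum_freeHecke z'.1
    have key (s : S) := unitFU_self_bijective.surjective
      (((functorU k I).map ((functorF k I).map (freeHeckeπ k I s))).hom z)
    choose h hh using key
    refine ⟨∑ s ∈ t, (freeHeckeι k I s).hom (h s), ?_⟩
    rw [map_sum]
    apply Subtype.ext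
    refine Eq.trans ?_ (ht t subset_rfl).symm
    refine (map_sum (invSpace I (tensorObj (freeHecke k I S))).subtype _ t).trans ?_
    refine Finset.sum_congr rfl fun s _ => ?_
    rw [unitFU_naturality, hh]
    rfl

end

theorem isIso_unitFU (M : ModuleCat.{u} (Hecke k I)) [Projective M] : IsIso (unitFU M) := by
  rw [ConcreteCategory.isIso_iff_bijective]
  have : Module.Projective (Hecke k I) M := (IsProjective.iff_projective _).2 inferInstance
  obtain ⟨s, hs⟩ := Module.projective_def'.1 this
  exact unitFU_bijective_of_retract (N := freeHecke k I M)
    { i := ModuleCat.ofHom s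
      r := ModuleCat.ofHom (Finsupp.linearCombination (Hecke k I) id)
      retract := ModuleCat.hom_ext hs } unitFU_free_bijective

end

/-! ### Disks and lifting against termwise surjections -/

namespace ChainComplex

section

variable {A : Type*} [Category* A] [Preadditive A] [HasZeroObject A]

open scoped Classical in
/-- Morphisms to a disk. -/
noncomputable def homToDisk {X : ChainComplex A ℤ} {N : A} {n : ℤ} (f : X.X n ⟶ N) :
    X ⟶ disk N n where
  f i :=
    -- Compatibility with the identity differential of the disk forces the component in degree `n +
    -- 1` to be `d` followed by `f`.
    if h₀ : i = n + 1 then X.d i n ≫ f ≫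
      (HomologicalComplex.doubleXIso₀ (𝟙 N) (int_rel n)).inv ≫ eqToHom (by rw [h₀])
    else if h₁ : i = n then eqToHom (by rw [h₁]) ≫ f ≫
      (HomologicalComplex.doubleXIso₁ (𝟙 N) (int_rel n) (int_succ_ne n)).inv ≫
        eqToHom (by rw [h₁])
    else 0
  comm' i j hij := by
    obtain rfl : j + 1 = i := hij
    by_cases h₁ : j = n
    · subst h₁
      simp [HomologicalComplex.double_d]
    · rw [HomologicalComplex.double_d_eq_zero₁ _ _ _ _ h₁, comp_zero]
      by_cases h₀ : j = n + 1
      · subst h₀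
        simp
      · simp [h₀, h₁]

theorem homToDisk_f {X : ChainComplex A ℤ} {N : A} {n : ℤ} (f : X.X n ⟶ N) :
    (homToDisk f).f n =
      f ≫ (HomologicalComplex.doubleXIso₁ (𝟙 N) (int_rel n) (int_succ_ne n)).inv := by
  simp [homToDisk, (int_succ_ne n).symm]

/-- The functoriality of disks. -/
noncomputable def diskMap {M N : A} (g : M ⟶ N) (n : ℤ) : disk M n ⟶ disk N n :=
  diskDesc (g ≫ (HomologicalComplex.doubleXIso₀ (𝟙 N) (int_rel n)).inv)

theorem diskMap_f {M N : A} (g : M ⟶ N) (n : ℤ) :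
    (diskMap g n).f n =
      (HomologicalComplex.doubleXIso₁ (𝟙 M) (int_rel n) (int_succ_ne n)).hom ≫ g ≫
        (HomologicalComplex.doubleXIso₁ (𝟙 N) (int_rel n) (int_succ_ne n)).inv := by
  simp [diskMap, diskDesc_f', HomologicalComplex.double_d _ _ (int_succ_ne n)]

/-- Morphisms between disks are homotopy equivalences. -/
noncomputable def diskHomotopyEquiv {M N : A} (g : M ⟶ N) (n : ℤ) :
    HomotopyEquiv (disk M n) (disk N n) where
  hom := diskMap g n
  inv := 0
  homotopyHomInvId := (Homotopy.ofEq (by simp)).trans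
    ((Homotopy.ofEq (eq_diskDesc (𝟙 _))).trans (diskHomotopy _)).symm
  homotopyInvHomId := (Homotopy.ofEq (by simp)).trans
    ((Homotopy.ofEq (eq_diskDesc (𝟙 _))).trans (diskHomotopy _)).symm

theorem rlp_diskInclusions_diskMap {P M N : A} (g : M ⟶ N)
    (hg : ∀ β : P ⟶ N, ∃ γ : P ⟶ M, γ ≫ g = β) (n : ℤ) :
    (diskInclusions P).rlp (diskMap g n) := by
  rw [rlp_diskInclusions_iff]
  intro i β
  by_cases h₀ : i = n + 1
  · subst h₀
    obtain ⟨γ, hγ⟩ := hg (β ≫ (HomologicalComplex.doubleXIso₀ (𝟙 N) (int_rel n)).hom)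
    refine ⟨γ ≫ (HomologicalComplex.doubleXIso₀ (𝟙 M) (int_rel n)).inv, ?_⟩
    simp [diskMap, diskDesc_f, reassoc_of% hγ]
  · by_cases h₁ : i = n
    · subst h₁
      obtain ⟨γ, hγ⟩ := hg (β ≫
        (HomologicalComplex.doubleXIso₁ (𝟙 N) (int_rel i) (int_succ_ne i)).hom)
      refine ⟨γ ≫
        (HomologicalComplex.doubleXIso₁ (𝟙 M) (int_rel i) (int_succ_ne i)).inv, ?_⟩
      simp [diskMap_f, reassoc_of% hγ]
    · exact ⟨0, (HomologicalComplex.isZero_double_X _ _ _ h₀ h₁).eq_of_tgt _ _⟩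

end

/-- The terms of a complex `X` such that `0 ⟶ X` has the left lifting property with respect to
termwise surjective quasi-isomorphisms are projective. -/
theorem projective_X_of_llp {A : Type*} [Category.{v} A] [Preadditive A] [HasZeroObject A]
    {R : Type*} [Ring R] {U : A ⥤ ModuleCat.{w} R} [U.Additive] {P : A} [Projective P]
    (e : ∀ V, (P ⟶ V) ≃+ U.obj V)
    (he : ∀ {V W : A} (g : P ⟶ V) (f : V ⟶ W), e W (g ≫ f) = U.map f (e V g))
    {Z X : ChainComplex A ℤ} (hZ : IsZero Z) (z : Z ⟶ X) (hz : (sphereInclusions P).rlp.llp z)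
    (n : ℤ) : Projective (X.X n) where
  factors {M N} f g _ := by
    -- Disks are contractible, so an epimorphism `g` induces a trivial fibration of disks;
    -- projectivity of `P` gives surjectivity on maps from `P`.
    have h : (sphereInclusions P).rlp (diskMap g n) := by
      rw [Functor.rlp_sphereInclusions_eq e he]
      exact ⟨rlp_diskInclusions_diskMap g
        (fun β => ⟨Projective.factorThru β g, Projective.factorThru_comp β g⟩) n,
        U.quasiIsoInverseImage_of_homotopyEquiv (diskHomotopyEquiv g n)⟩
    have := hz _ h
    -- The degree `n` component of the lift solves the original lifting problem for `f` against `g`.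
    have sq : CommSq (0 : Z ⟶ _) z (diskMap g n) (homToDisk f) := ⟨hZ.eq_of_src _ _⟩
    have h₁ := HomologicalComplex.congr_hom sq.fac_right n
    rw [HomologicalComplex.comp_f, homToDisk_f, diskMap_f, ← Category.assoc, ← Category.assoc,
      cancel_mono, Category.assoc] at h₁
    exact ⟨_, (Category.assoc _ _ _).trans h₁⟩

end ChainComplex

/-! ### Functorial cofibrant replacements -/

/-- The functorial factorization is applied to the maps from the initial object, which depend
functorially on their target through `A`. -/
theorem CategoryTheory.MorphismProperty.exists_functorial_resolution {C : Type*} [Category* C]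
    [HasInitial C] (W₁ W₂ : MorphismProperty C) [W₁.HasFunctorialFactorization W₂] :
    ∃ (R : C ⥤ C) (q : R ⟶ 𝟭 C), (∀ X, W₂ (q.app X)) ∧ ∀ X, W₁ (initial.to (R.obj X)) := by
  let data := functorialFactorizationData W₁ W₂
  let A : C ⥤ Arrow C :=
    { obj := fun X => CategoryTheory.Arrow.mk (initial.to X)
      map := fun f => CategoryTheory.Arrow.homMk (𝟙 _) f (initialIsInitial.hom_ext _ _) }
  exact ⟨A ⋙ data.Z, { app := fun X => data.p.app (A.obj X)
                       naturality := fun _ _ f => data.p.naturality (A.map f) },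
    fun X => data.hp _, fun X => by
      have h : initial.to (data.Z.obj (A.obj X)) = data.i.app (A.obj X) :=
        initialIsInitial.hom_ext _ _
      exact h.symm ▸ data.hi (A.obj X)⟩

/-! ### The model structures -/

section

open ChainComplex

variable (R : Type u) [Ring R]

theorem moduleCat_rlp_diskInclusions_iff {M N : ChainComplex (ModuleCat.{u} R) ℤ} (f : M ⟶ N) :
    (diskInclusions (ModuleCat.of R R)).rlp f ↔ ∀ n, Function.Surjective (f.f n).hom :=
  Functor.rlp_diskInclusions_iff_surjective (U := 𝟭 _) (moduleCatSelfHomEquiv R)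
    (fun _ _ => rfl) f

theorem moduleCat_rlp_sphereInclusions_eq :
    (sphereInclusions (ModuleCat.of R R)).rlp = (diskInclusions (ModuleCat.of R R)).rlp ⊓
      HomologicalComplex.quasiIso (ModuleCat.{u} R) (ComplexShape.down ℤ) :=
  Functor.rlp_sphereInclusions_eq (U := 𝟭 _) (moduleCatSelfHomEquiv R) (fun _ _ => rfl)

theorem moduleCat_rlp_diskInclusions_llp_le :
    (diskInclusions (ModuleCat.of R R)).rlp.llp ≤
      HomologicalComplex.quasiIso (ModuleCat.{u} R) (ComplexShape.down ℤ) :=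
  Functor.rlp_diskInclusions_llp_le (𝟭 (ModuleCat.{u} R)) _

/-- The projective model structure on complexes of modules. -/
noncomputable abbrev moduleCatProjectiveModelCategory :
    ModelCategory (ChainComplex (ModuleCat.{u} R) ℤ) :=
  MorphismProperty.modelCategoryOfGenerators _ _ _ (moduleCat_rlp_sphereInclusions_eq R)
    (moduleCat_rlp_diskInclusions_llp_le R)

theorem moduleCat_projective_X_of_llp {Z X : ChainComplex (ModuleCat.{u} R) ℤ} (hZ : IsZero Z)
    (z : Z ⟶ X) (hz : (sphereInclusions (ModuleCat.of R R)).rlp.llp z) (n : ℤ) :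
    Projective (X.X n) :=
  projective_X_of_llp (U := 𝟭 _) (moduleCatSelfHomEquiv R) (fun _ _ => rfl) hZ z hz n

end

/-! ### The `I`-projective structure and comparison with modules. -/

section

open ChainComplex

variable {k G : Type u} [Field k] [Group G] [TopologicalSpace G] [IsTopologicalGroup G]
  (I : OpenSubgroup G) [CompactSpace I]

attribute [local instance] SmoothRep.hasLimitsOfSize SmoothRep.hasColimitsOfSize

theorem smoothRep_rlp_diskInclusions_iff {V W : ChG k G} (f : V ⟶ W) :
    (diskInclusions (cInd k I)).rlp f ↔
      ∀ n, Function.Surjective (((chU k I).map f).f n).hom :=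
  Functor.rlp_diskInclusions_iff_surjective (U := functorU k I) (frobEquiv I)
    (fun _ _ => rfl) f

theorem smoothRep_rlp_sphereInclusions_eq :
    (sphereInclusions (cInd k I)).rlp = (diskInclusions (cInd k I)).rlp ⊓
      (functorU k I).quasiIsoInverseImage :=
  Functor.rlp_sphereInclusions_eq (U := functorU k I) (frobEquiv I) (fun _ _ => rfl)

variable (k) in
/-- The `I`-projective model structure. -/
noncomputable abbrev smoothRepProjectiveModelCategory : ModelCategory (ChG k G) :=
  MorphismProperty.modelCategoryOfGenerators _ _ _ (smoothRep_rlp_sphereInclusions_eq I)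
    (Functor.rlp_diskInclusions_llp_le (functorU k I) _)

variable {I}

theorem rlp_diskInclusions_chU {V W : ChG k G} {f : V ⟶ W}
    (hf : (diskInclusions (cInd k I)).rlp f) :
    (diskInclusions (ModuleCat.of (Hecke k I) (Hecke k I))).rlp ((chU k I).map f) :=
  (moduleCat_rlp_diskInclusions_iff _ _).2 ((smoothRep_rlp_diskInclusions_iff I f).1 hf)

theorem rlp_sphereInclusions_chU {V W : ChG k G} {f : V ⟶ W}
    (hf : (sphereInclusions (cInd k I)).rlp f) :
    (sphereInclusions (ModuleCat.of (Hecke k I) (Hecke k I))).rlp ((chU k I).map f) := by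
  rw [smoothRep_rlp_sphereInclusions_eq] at hf
  rw [moduleCat_rlp_sphereInclusions_eq]
  exact ⟨rlp_diskInclusions_chU hf.1, hf.2⟩

/-- The unit of `F ⊣ U` is an isomorphism on complexes of projective modules. -/
theorem isIso_chAdj_unit_app (X : ChH k I) (hX : ∀ n, Projective (X.X n)) :
    IsIso ((chAdj k I).unit.app X) := by
  have (n : ℤ) : IsIso (((chAdj k I).unit.app X).f n) := isIso_unitFU (X.X n)
  exact HomologicalComplex.Hom.isIso_of_components _

/-- If the unit of an adjunction is an isomorphism at `X`, a morphism `F X ⟶ Y` belongs to the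
inverse image of `W` by `U` if and only if its adjoint belongs to `W`. -/
theorem CategoryTheory.Adjunction.homEquiv_mem_iff {C D : Type*} [Category* C] [Category* D]
    {F : C ⥤ D} {U : D ⥤ C} (adj : F ⊣ U) (W : MorphismProperty C) [W.RespectsIso] {X : C} {Y : D}
    [IsIso (adj.unit.app X)] (f : F.obj X ⟶ Y) : W (adj.homEquiv X Y f) ↔ W (U.map f) := by
  rw [Adjunction.homEquiv_unit]
  exact W.cancel_left_of_respectsIso _ _

end

/-! ### The Quillen equivalence and its derived equivalence. -/

theorem mainTheorem8 (p : ℕ) [Fact p.Prime] (k G : Type u) [Field k] [CharP k p]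
    [Group G] [TopologicalSpace G] [IsTopologicalGroup G] (I : OpenSubgroup G)
    [CompactSpace I] [T2Space I] [TotallyDisconnectedSpace I] (hI : IsProP p I) :
    ∃ (_ : ModelCategory (ChH k I)) (_ : ModelCategory (ChG k G)),
      -- the first model structure is the projective model structure on `Ch(H)`
      IsBicompleteFunctorial.{u} (ChH k I) ∧
      (∀ {X Y : ChH k I} (f : X ⟶ Y), fibrations (ChH k I) f ↔
        ∀ n : ℤ, Function.Surjective (f.f n).hom) ∧
      (∀ {X Y : ChH k I} (f : X ⟶ Y), weakEquivalences (ChH k I) f ↔ QuasiIso f) ∧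
      -- the second one is the `I`-projective model structure on `Ch(G)`
      IsBicompleteFunctorial.{u} (ChG k G) ∧
      IsCofibrantlyGenerated.{u} (ChG k G) ∧
      (∀ {V W : ChG k G} (f : V ⟶ W), fibrations (ChG k G) f ↔
        ∀ n : ℤ, Function.Surjective (((chU k I).map f).f n).hom) ∧
      (∀ {V W : ChG k G} (f : V ⟶ W), weakEquivalences (ChG k G) f ↔
        QuasiIso ((chU k I).map f)) ∧
      -- `F ⊣ U` is a Quillen equivalence
      IsQuillenEquivalence (chAdj k I) ∧
      -- the derived adjunction exists and is an adjoint equivalence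
      ∃ (LF : DerivedH k I ⥤ HomotopyCat (ChG k G))
        (RU : HomotopyCat (ChG k G) ⥤ DerivedH k I)
        (α : DerivedH.Q k I ⋙ LF ⟶ chF k I ⋙ HomotopyCat.Q (ChG k G))
        (β : chU k I ⋙ DerivedH.Q k I ⟶ HomotopyCat.Q (ChG k G) ⋙ RU)
        (adj : LF ⊣ RU),
        -- `LF` is the total left derived functor of `F`, computed on cofibrant complexes
        LF.IsLeftDerivedFunctor α
          (HomologicalComplex.quasiIso (ModuleCat.{u} (Hecke k I)) (ComplexShape.down ℤ)) ∧
        (∀ X : ChH k I, IsCofibrant X → IsIso (α.app X)) ∧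
        -- `RU` is the total right derived functor of `U`, computed on fibrant complexes
        RU.IsRightDerivedFunctor β (weakEquivalences (ChG k G)) ∧
        (∀ V : ChG k G, IsFibrant V → IsIso (β.app V)) ∧
        -- `LF ⊣ RU` is the adjunction induced by `F ⊣ U`
        (∀ X : ChH k I,
          adj.unit.app ((DerivedH.Q k I).obj X) ≫ RU.map (α.app X) =
            (DerivedH.Q k I).map ((chAdj k I).unit.app X) ≫ β.app ((chF k I).obj X)) ∧
        (∀ V : ChG k G,
          LF.map (β.app V) ≫ adj.counit.app ((HomotopyCat.Q (ChG k G)).obj V) =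
            α.app ((chU k I).obj V) ≫
              (HomotopyCat.Q (ChG k G)).map ((chAdj k I).counit.app V)) ∧
        -- it is an equivalence of categories
        IsIso adj.unit ∧ IsIso adj.counit := by
  let SH := ChainComplex.sphereInclusions (ModuleCat.of (Hecke k I) (Hecke k I))
  let TH := ChainComplex.diskInclusions (ModuleCat.of (Hecke k I) (Hecke k I))
  let WH := HomologicalComplex.quasiIso (ModuleCat.{u} (Hecke k I)) (ComplexShape.down ℤ)
  let SG := ChainComplex.sphereInclusions (cInd k I)
  let TG := ChainComplex.diskInclusions (cInd k I)
  let WG := (functorU k I).quasiIsoInverseImage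
  have hH₁ : SH.rlp = TH.rlp ⊓ WH := moduleCat_rlp_sphereInclusions_eq _
  have hH₂ : TH.rlp.llp ≤ WH := moduleCat_rlp_diskInclusions_llp_le _
  have hG₁ : SG.rlp = TG.rlp ⊓ WG := smoothRep_rlp_sphereInclusions_eq I
  have hG₂ : TG.rlp.llp ≤ WG := Functor.rlp_diskInclusions_llp_le (functorU k I) _
  have := ChainComplex.hasColimitsOfSize.{u} (ModuleCat.{u} (Hecke k I))
  have := ChainComplex.hasLimitsOfSize.{u} (ModuleCat.{u} (Hecke k I))
  have : HasColimitsOfSize.{u, u} (SmoothRep k G) := SmoothRep.hasColimitsOfSize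
  have : HasLimitsOfSize.{u, u} (SmoothRep k G) := SmoothRep.hasLimitsOfSize
  have := ChainComplex.hasColimitsOfSize.{u} (SmoothRep k G)
  have := ChainComplex.hasLimitsOfSize.{u} (SmoothRep k G)
  let := moduleCatProjectiveModelCategory (Hecke k I)
  let := smoothRepProjectiveModelCategory k I
  have hX (X : ChH k I) (hX : IsCofibrant X) : IsIso ((chAdj k I).unit.app X) :=
    isIso_chAdj_unit_app X (moduleCat_projective_X_of_llp _
      (IsZero.of_iso (isZero_zero _) (initialIsInitial.uniqueUpToIso HasZeroObject.zeroIsInitial))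
      (initial.to X) hX.mem)
  -- The adjoint of `f` is the unit at `X`, an isomorphism, followed by `U f`.
  have hWU ⦃X : ChH k I⦄ ⦃Y : ChG k G⦄ (hX' : IsCofibrant X) (f : (chF k I).obj X ⟶ Y) :
      WH ((chAdj k I).homEquiv X Y f) ↔ WG f :=
    haveI := hX X hX'
    (chAdj k I).homEquiv_mem_iff WH f
  refine ⟨inferInstance, inferInstance,
    MorphismProperty.isBicompleteFunctorial_modelCategoryOfGenerators hH₁ hH₂,
    moduleCat_rlp_diskInclusions_iff _, fun _ => Iff.rfl,
    MorphismProperty.isBicompleteFunctorial_modelCategoryOfGenerators hG₁ hG₂,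
    MorphismProperty.isCofibrantlyGenerated_modelCategoryOfGenerators hG₁ hG₂
      (ChainComplex.isFinitelyPresentable_of_sphereInclusions _)
      (ChainComplex.isFinitelyPresentable_of_diskInclusions _),
    smoothRep_rlp_diskInclusions_iff I, fun _ => Iff.rfl,
    -- `U` preserves the right lifting classes, so the adjunction transfers the left lifting
    -- properties through `F`.
    { cofibration := fun f hf V W g hg => ((chAdj k I).hasLiftingProperty_iff f g).2
        (hf _ (rlp_sphereInclusions_chU hg))
      trivialCofibration := fun f hf => by
        rw [MorphismProperty.trivialCofibrations_modelCategoryOfGenerators hH₁ hH₂] at hf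
        rw [MorphismProperty.trivialCofibrations_modelCategoryOfGenerators hG₁ hG₂]
        exact fun V W g hg => ((chAdj k I).hasLiftingProperty_iff f g).2
          (hf _ (rlp_diskInclusions_chU hg))
      weakEquivalence_iff := fun X Y _ _ f => (hWU inferInstance f).symm }, ?_⟩
  obtain ⟨R, q, hq, hR⟩ := MorphismProperty.exists_functorial_resolution SH.rlp.llp SH.rlp
  obtain ⟨LF, RU, α, β, adj, h₁, h₂, h₃, h₄, h₅⟩ := exists_derived_adjoint_equivalence
    (chAdj k I) (W₁ := WH) (W₂ := WG) q
    (fun X => (hH₁.le _ (hq X)).2) IsCofibrant (fun X => ⟨hR X⟩)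
    (fun X Y f hX' hY' hf => by
      have := hX X hX'
      have := hX Y hY'
      -- By naturality the unit isomorphisms identify `U F f` with `f`, so `F` preserves weak
      -- equivalences between cofibrant complexes.
      refine (WH.cancel_left_of_respectsIso ((chAdj k I).unit.app X) _).1 ?_
      refine ((chAdj k I).unit.naturality f) ▸ ?_
      exact (WH.cancel_right_of_respectsIso f _).2 hf) (fun _ _ _ hf => hf)
    (fun X Y f hX' hf => (hWU hX' f).1 hf) (fun X hX' => by
      have := hX X hX'
      exact WH.of_isIso _)
  exact ⟨LF, RU, α, β, adj, h₁, h₂, h₃, fun V _ => h₄ V, h₅⟩
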